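/- Let $n\ge 0$ be an integer, $q\neq 0$ a real number, and $\Theta=(\theta_{i,j})_{1\le i,j\le n}$ complex numbers with $\theta_{i,i}=1$, $|\theta_{i,j}|=1$ and $\overline{\theta_{i,j}}=\theta_{j,i}$. Let $$R=\sum_{i} q\,E_{i,i}\otimes E_{i,i}+\sum_{i\ne j}\theta_{j,i}\,E_{i,i}\otimes E_{j,j}+\sum_{i>j}(q-q^{-1})\,E_{i,j}\otimes E_{j,i}$$ be the Hayashi $R$-matrix, $R=\sum R_{ab,cd}\,E_{a,c}\otimes E_{b,d}$, and put $w_k=\prod_{r\ne k}\theta_{r,k}$ and $\kappa_k=\prod_{r>k}\theta_{r,k}$. For $I=\{i_1<\dots<i_r\}$ and $J=\{j_1<\dots<j_r\}$ define the quantum minor $$[D^I_J]=\sum_{\sigma\in S_r}\Big(\prod_{x<y,\ \sigma(x)>\sigma(y)}(-q\,\theta_{i_{\sigma(y)},i_{\sigma(x)}})\Big)V_{i_{\sigma(1)},j_1}\cdots V_{i_{\sigma(r)},j_r};$$ let $Det_q$ be the minor with all rows and columns, and $M_{i,k}$ the minor with row $i$ and column $k$ removed. Let $\mathbb{C}[U_{q,\Theta}(n)]$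 be the unital $\mathbb{C}$-algebra with generators $V_{i,j}$ ($1\le i,j\le n$) and $\mathscr{D}^{-1}$ and relations, for all $i,j,r,s,k$, $$\sum_{k,l}R_{ji,kl}V_{k,r}V_{l,s}=\sum_{k,l}R_{lk,rs}V_{i,k}V_{j,l},\qquad w_k V_{i,k}\mathscr{D}^{-1}=w_i\mathscr{D}^{-1}V_{i,k},\qquad Det_q\,\mathscr{D}^{-1}=1 .$$ Theorem. There is a unique Hopf algebra structure on the algebra $\mathbb{C}[U_{q,\Theta}(n)]$ with $$\Delta(V_{i,j})=\sum_k V_{i,k}\otimes V_{k,j},\quad \epsilon(V_{i,j})=\delta_{i,j},\quad \Delta(\mathscr{D}^{-1})=\mathscr{D}^{-1}\otimes\mathscr{D}^{-1},\quad \epsilon(\mathscr{D}^{-1})=1 .$$ Its antipode $S$ satisfies, for all $i,k$, $$S(V_{i,k})=\frac{\kappa_i}{\kappa_k}(-q)^{i-k}\,\mathscr{D}^{-1}M_{k,i},\qquad S(\mathscr{D}^{-1})=Det_q,$$ and $S^2(V_{i,j})=q^{2(i-j)}V_{i,j}$ for all $i,j$. Moreover, there is a unique conjugate-linear unital ring homomorphism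 $\omega$ of $\mathbb{C}[U_{q,\Theta}(n)]$ with $\omega(V_{i,j})=V_{j,i}$ and $\omega(\mathscr{D}^{-1})=\mathscr{D}^{-1}$, and $*=S\circ\omega$ makes $\mathbb{C}[U_{q,\Theta}(n)]$ a Hopf $*$-algebra: $*$ is a conjugate-linear, anti-multiplicative involution, $\Delta$ and $\epsilon$ are $*$-homomorphisms (with $(a\otimes b)^*=a^*\otimes b^*$), and $S\circ *\circ S\circ *=\mathrm{id}$. -/

import Mathlib

open scoped TensorProduct ComplexConjugate

noncomputable section

namespace QuantumU

/-- The deformation parameters: a matrix `Θ = (θ_{i,j})` of complex numbers of modulus one with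
unit diagonal and `conj θ_{i,j} = θ_{j,i}` (hence `θ_{j,i} = 1 / θ_{i,j}`). -/
structure IsParam {n : ℕ} (θ : Fin n → Fin n → ℂ) : Prop where
  diag : ∀ i, θ i i = 1
  norm_eq_one : ∀ i j, ‖θ i j‖ = 1
  conj_eq : ∀ i j, conj (θ i j) = θ j i

/-- The Hayashi `R`-matrix
`R = ∑ᵢ q E_{ii} ⊗ E_{ii} + ∑_{i ≠ j} θ_{ji} E_{ii} ⊗ E_{jj} + ∑_{i > j} (q - q⁻¹) E_{ij} ⊗ E_{ji}`,
given by its entries: `R_{ab,cd}`, the coefficient of `E_{ac} ⊗ E_{bd}`, is the entry at row `(a, b)`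
and column `(c, d)`. So `R_{ii,ii} = q`, `R_{ij,ij} = θ_{ji}` for `i ≠ j`,
`R_{ij,ji} = q - q⁻¹` for `i > j`, and all other entries vanish. -/
def hayashiR {n : ℕ} (q : ℝ) (θ : Fin n → Fin n → ℂ) :
    Matrix (Fin n × Fin n) (Fin n × Fin n) ℂ :=
  Matrix.of fun x y =>
    if x = y then (if x.1 = x.2 then (q : ℂ) else θ x.2 x.1)
    else if x.2 < x.1 ∧ y = (x.2, x.1) then (q : ℂ) - (q : ℂ)⁻¹
    else 0

/-- `w_k = ∏_{r ≠ k} θ_{r,k}`. -/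
def weight {n : ℕ} (θ : Fin n → Fin n → ℂ) (k : Fin n) : ℂ := ∏ r ∈ {k}ᶜ, θ r k

/-- `κ_k = θ_{k+1,k} θ_{k+2,k} ⋯ θ_{n,k}`. -/
def kappa {n : ℕ} (θ : Fin n → Fin n → ℂ) (k : Fin n) : ℂ := ∏ r ∈ Finset.Ioi k, θ r k

/-- For a matrix `v` with entries in an algebra `B`, rows `i₁ < ⋯ < i_r` and columns
`j₁ < ⋯ < j_r` (given as functions `I`, `J`), the quantum minor
`∑_σ (∏_{x < y, σ x > σ y} (-q θ_{i_{σ y}, i_{σ x}})) v_{i_{σ 1}, j₁} ⋯ v_{i_{σ r}, j_r}`. -/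
def qMinor {B : Type*} [Ring B] [Algebra ℂ B] {n : ℕ} (q : ℝ) (θ : Fin n → Fin n → ℂ)
    (v : Fin n → Fin n → B) {r : ℕ} (I J : Fin r → Fin n) : B :=
  ∑ σ : Equiv.Perm (Fin r),
    (∏ p : Fin r × Fin r with p.1 < p.2 ∧ σ p.2 < σ p.1,
        (-(q : ℂ) * θ (I (σ p.2)) (I (σ p.1)))) •
      (List.ofFn fun x => v (I (σ x)) (J x)).prod

/-- The quantum determinant: the quantum minor with all rows and all columns. -/
def qDet {B : Type*} [Ring B] [Algebra ℂ B] {n : ℕ} (q : ℝ) (θ : Fin n → Fin n → ℂ)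
    (v : Fin n → Fin n → B) : B :=
  qMinor q θ v (id : Fin n → Fin n) id

/-- The increasing enumeration of all indices different from `i`. -/
def omit1 {n : ℕ} (i : Fin n) : Fin (n - 1) → Fin n :=
  ({i}ᶜ : Finset (Fin n)).orderEmbOfFin (by simp [Finset.card_compl])

/-- `M_{i,k}`: the quantum minor with row `i` and column `k` removed. -/
def qCofactor {B : Type*} [Ring B] [Algebra ℂ B] {n : ℕ} (q : ℝ) (θ : Fin n → Fin n → ℂ)
    (v : Fin n → Fin n → B) (i k : Fin n) : B :=
  qMinor q θ v (omit1 i) (omit1 k)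

/-- The generators `V_{i,j}` and `𝒟⁻¹`. -/
inductive Gen (n : ℕ) : Type
  | V (i j : Fin n) : Gen n
  | Dinv : Gen n

/-- The generator `V_{i,j}` in the free algebra. -/
def freeV {n : ℕ} (i j : Fin n) : FreeAlgebra ℂ (Gen n) := FreeAlgebra.ι ℂ (Gen.V i j)

/-- The generator `𝒟⁻¹` in the free algebra. -/
def freeDinv {n : ℕ} : FreeAlgebra ℂ (Gen n) := FreeAlgebra.ι ℂ Gen.Dinv

/-- The defining relations of `ℂ[U_{q,Θ}(n)]`: the FRT relations `R V₁ V₂ = V₂ V₁ R`, the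
commutation relations of `𝒟⁻¹` with the `V_{i,k}`, and `Det_q 𝒟⁻¹ = 1`. -/
inductive Rel {n : ℕ} (q : ℝ) (θ : Fin n → Fin n → ℂ) :
    FreeAlgebra ℂ (Gen n) → FreeAlgebra ℂ (Gen n) → Prop
  | frt (i j r s : Fin n) : Rel q θ
      (∑ k, ∑ l, hayashiR q θ (j, i) (k, l) • (freeV k r * freeV l s))
      (∑ k, ∑ l, hayashiR q θ (l, k) (r, s) • (freeV i k * freeV j l))
  | comm (i k : Fin n) : Rel q θ
      (weight θ k • (freeV i k * freeDinv)) (weight θ i • (freeDinv * freeV i k))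
  | det : Rel q θ (qDet q θ freeV * freeDinv) 1

/-- The algebra `ℂ[U_{q,Θ}(n)]`. -/
def CU (n : ℕ) (q : ℝ) (θ : Fin n → Fin n → ℂ) : Type := RingQuot (Rel q θ)

instance CU.ring (n : ℕ) (q : ℝ) (θ : Fin n → Fin n → ℂ) : Ring (CU n q θ) :=
  inferInstanceAs (Ring (RingQuot (Rel q θ)))

/-- The `ℂ`-algebra structure of `ℂ[U_{q,Θ}(n)]` as a quotient of the free algebra. -/
instance CU.algebra (n : ℕ) (q : ℝ) (θ : Fin n → Fin n → ℂ) : Algebra ℂ (CU n q θ) :=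
  inferInstanceAs (Algebra ℂ (RingQuot (Rel q θ)))

/-- The quotient map from the free algebra onto `ℂ[U_{q,Θ}(n)]`. -/
def CU.mk {n : ℕ} (q : ℝ) (θ : Fin n → Fin n → ℂ) : FreeAlgebra ℂ (Gen n) →ₐ[ℂ] CU n q θ :=
  RingQuot.mkAlgHom ℂ (Rel q θ)

/-- The generator `V_{i,j}` of `ℂ[U_{q,Θ}(n)]`. -/
def V {n : ℕ} (q : ℝ) (θ : Fin n → Fin n → ℂ) (i j : Fin n) : CU n q θ := CU.mk q θ (freeV i j)

/-- The generator `𝒟⁻¹` of `ℂ[U_{q,Θ}(n)]`. -/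
def Dinv {n : ℕ} (q : ℝ) (θ : Fin n → Fin n → ℂ) : CU n q θ := CU.mk q θ freeDinv

/-- The quantum determinant `Det_q` in `ℂ[U_{q,Θ}(n)]`. -/
def Det {n : ℕ} (q : ℝ) (θ : Fin n → Fin n → ℂ) : CU n q θ := qDet q θ (V q θ)

/-- The quantum minor `M_{i,k}` in `ℂ[U_{q,Θ}(n)]`: row `i` and column `k` are removed. -/
def M {n : ℕ} (q : ℝ) (θ : Fin n → Fin n → ℂ) (i k : Fin n) : CU n q θ :=
  qCofactor q θ (V q θ) i k

/-- The comultiplication and the counit of the Hopf algebra `A` take the prescribed values on the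
elements `v i j` and `d`: `Δ(v_{ij}) = ∑ₖ v_{ik} ⊗ v_{kj}`, `ε(v_{ij}) = δ_{ij}`,
`Δ(d) = d ⊗ d`, `ε(d) = 1`. -/
structure IsMatrixCoalgebra {A : Type*} [Semiring A] [HopfAlgebra ℂ A] {n : ℕ}
    (v : Fin n → Fin n → A) (d : A) : Prop where
  comul_v : ∀ i j, Coalgebra.comul (R := ℂ) (v i j) = ∑ k, v i k ⊗ₜ[ℂ] v k j
  counit_v : ∀ i j, Coalgebra.counit (R := ℂ) (v i j) = if i = j then 1 else 0
  comul_d : Coalgebra.comul (R := ℂ) d = d ⊗ₜ[ℂ] d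
  counit_d : Coalgebra.counit (R := ℂ) d = 1

/-- A Hopf algebra structure on the algebra `ℂ[U_{q,Θ}(n)]` (its underlying algebra structure is
the given one) whose comultiplication and counit take the prescribed values on the generators. -/
structure IsHopfStructure {n : ℕ} (q : ℝ) (θ : Fin n → Fin n → ℂ)
    (H : HopfAlgebra ℂ (CU n q θ)) : Prop where
  algebra_eq : H.toAlgebra = CU.algebra n q θ
  matrix_coalgebra : IsMatrixCoalgebra (V q θ) (Dinv q θ)

/-- `ω` is conjugate-linear and multiplicative with `ω(V_{i,j}) = V_{j,i}` and
`ω(𝒟⁻¹) = 𝒟⁻¹`. -/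
structure IsTranspose {n : ℕ} (q : ℝ) (θ : Fin n → Fin n → ℂ)
    (ω : CU n q θ →+* CU n q θ) : Prop where
  map_smul : ∀ (c : ℂ) (a : CU n q θ), ω (c • a) = conj c • ω a
  map_V : ∀ i j, ω (V q θ i j) = V q θ j i
  map_Dinv : ω (Dinv q θ) = Dinv q θ

/-- A Hopf `*`-algebra structure on a complex Hopf algebra `A`: a conjugate-linear, involutive,
anti-multiplicative operation `*` for which the comultiplication and the counit are
`*`-homomorphisms, where `(a ⊗ b)* = a* ⊗ b*`. -/
class HopfStarAlgebra (A : Type*) [Semiring A] [HopfAlgebra ℂ A] extends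
    StarRing A, StarModule ℂ A where
  comul_star : ∀ a : A, Coalgebra.comul (R := ℂ) (Star.star a) = Star.star (Coalgebra.comul (R := ℂ) a)
  counit_star : ∀ a : A, Coalgebra.counit (R := ℂ) (Star.star a) = Star.star (Coalgebra.counit (R := ℂ) a)

end QuantumU

end

/-!
The theorem rests on one observation: if `ξ_r = ∑ᵢ V_{i,r} ⊗ e_i` are the columns of the generator
matrix, with `e_i` the generators of the exterior algebra twisted by `e_j e_i = -q θ_{i,j} e_i e_j`
(`i < j`), then the FRT relations make the `ξ_r` satisfy the same twisted relations
(`IsFRT.isTwistedExterior_colVec`). Quantum minors are the coefficients of products of the `ξ_r`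
(`coeffAt_prod_ofFn_colVec`, `minor_eq_qMinor`), and identities between them are associativity and
straightening in the exterior algebra. To make coefficients well defined, the exterior algebra is
realized by creation operators on the space with basis the subsets of the index set.

In this way one obtains the Laplace expansions (`sum_qCofactor_mul`, `sum_mul_qCofactor`) and the
multiplicativity of the determinant (`qDet_mul`). Transposing `V` and `θ` preserves the FRT
relations and turns columns into rows, and the row expansion of a minor equals its column expansion
(`qMinor_transpose`): the double sum over row and column permutations computes each of them up to
the same factor `∑_σ q ^ (2 ℓ(σ))`, which is positive as `q` is real. Hence there are row
expansions as well.

The column expansion with minors on the left and the row expansion with minors on the right say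
that the matrix `invV` of the theorem is a two-sided inverse of `V` (`sum_invV_mul_V`,
`sum_V_mul_invV`). The inverse of an FRT matrix is an FRT matrix over the opposite algebra
(`IsFRT.op_inverse`), and its determinant there inverts that of `V` (`qDet_mul_unop_qDet_op`), so
the universal property gives an algebra map `S` into the opposite algebra. Likewise, `Δ` exists
because FRT matrices with commuting entries multiply, with multiplicative determinants. The axioms
are checked on generators. Uniqueness holds since `Δ` and `ε` are algebra maps and the antipode is
a convolution inverse.

The remaining formulas, for `S²`, `Δ ∘ S`, `ε ∘ S` and `S ∘ ω ∘ S`, all follow from the uniqueness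
of inverse matrices (`matrix_inverse_unique`). The powers of `q` in `S²` come from the remaining
row expansion, with minors on the left (`sum_invV_mul_V_swap`). The map `ω` is an algebra map into
the complex conjugate algebra and respects `Det_q 𝒟⁻¹ = 1` because of the equality of row and
column determinants.
-/

noncomputable section

namespace QuantumU

/-! ### Twisted exterior algebras -/

section Exterior

variable {ι K A : Type*} [LinearOrder ι] [CommRing K] [Ring A] [Algebra K A]

/-- The family `x` satisfies the relations of the exterior algebra twisted by `a`: squares vanish
and `x j * x i = a i j • (x i * x j)` for `i < j`. Only the values `a i j` with `i < j` matter. -/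
structure IsTwistedExterior (a : ι → ι → K) (x : ι → A) : Prop where
  sq : ∀ i, x i * x i = 0
  swap : ∀ i j, i < j → x j * x i = a i j • (x i * x j)

/-- The coefficient picked up when `x i` is multiplied from the left onto the increasing product
over `S` and moved to its place: zero if `i` already occurs, otherwise one factor for each smaller
index. -/
def insCoeff (a : ι → ι → K) (i : ι) (S : Finset ι) : K :=
  if i ∈ S then 0 else ∏ j ∈ S with j < i, a j i

/-- The product of the `x i`, `i ∈ S`, in increasing order of the indices. -/
def ordProd (x : ι → A) (S : Finset ι) : A := ((S.sort (· ≤ ·)).map x).prod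

@[simp] lemma ordProd_empty (x : ι → A) : ordProd x ∅ = 1 := by simp [ordProd]

lemma ordProd_insert_min (x : ι → A) {i : ι} {S : Finset ι} (h : ∀ j ∈ S, i < j) :
    ordProd x (insert i S) = x i * ordProd x S := by
  have hi : i ∉ S := fun hi => (h i hi).false
  rw [ordProd, Finset.sort_insert _ (fun b hb => (h b hb).le) hi]
  simp [ordProd]

lemma insCoeff_of_lt (a : ι → ι → K) {i : ι} {S : Finset ι} (h : ∀ j ∈ S, i < j) :
    insCoeff a i S = 1 := by
  rw [insCoeff, if_neg fun hi => (h i hi).false, Finset.filter_false_of_mem, Finset.prod_empty]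
  exact fun j hj => (h j hj).not_gt

lemma insCoeff_insert (a : ι → ι → K) {i j : ι} {S : Finset ι} (hj : j ∉ S) :
    insCoeff a i (insert j S) =
      (if i = j then 0 else if j < i then a j i else 1) * insCoeff a i S := by
  unfold insCoeff
  by_cases hij : i = j
  · simp [hij]
  by_cases hi : i ∈ S
  · simp [hi]
  simp only [Finset.mem_insert, hij, hi, or_self, if_false]
  rw [Finset.filter_insert]
  split_ifs with h
  · rw [Finset.prod_insert (by simp [hj])]
  · simp

lemma IsTwistedExterior.mul_ordProd {a : ι → ι → K} {x : ι → A} (hx : IsTwistedExterior a x)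
    (i : ι) (S : Finset ι) :
    x i * ordProd x S = insCoeff a i S • ordProd x (insert i S) := by
  induction S using Finset.induction_on_min with
  | empty => simp [insCoeff, ordProd]
  | insert j S hj ih =>
    have hjS : j ∉ S := fun h => (hj j h).false
    rw [insCoeff_insert a hjS, ordProd_insert_min x hj, ← mul_assoc]
    rcases lt_trichotomy i j with h | rfl | h
    · have h1 : ∀ k ∈ insert j S, i < k := by
        intro k hk
        rcases Finset.mem_insert.1 hk with rfl | hk
        · exact h
        · exact h.trans (hj k hk)
      rw [insCoeff_of_lt a fun k hk => h1 k (Finset.mem_insert_of_mem hk), if_neg h.ne,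
        if_neg h.not_gt, ordProd_insert_min x h1, ordProd_insert_min x hj]
      simp [mul_assoc]
    · simp [hx.sq]
    · have h1 : ∀ k ∈ insert i S, j < k := by
        intro k hk
        rcases Finset.mem_insert.1 hk with rfl | hk
        · exact h
        · exact hj k hk
      rw [hx.swap j i h, if_neg h.ne', if_pos h, smul_mul_assoc, mul_assoc, ih, mul_smul_comm,
        Finset.insert_comm, ordProd_insert_min x h1, smul_smul]

/-- The mirror image of `IsTwistedExterior.mul_ordProd`: a factor on the right passes the larger
indices. -/
lemma IsTwistedExterior.ordProd_mul {a : ι → ι → K} {x : ι → A} (hx : IsTwistedExterior a x)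
    (i : ι) (S : Finset ι) :
    ordProd x S * x i =
      (if i ∈ S then 0 else ∏ j ∈ S with i < j, a i j) • ordProd x (insert i S) := by
  induction S using Finset.induction_on_min with
  | empty => simp [ordProd]
  | insert j S hj ih =>
    have hjS : j ∉ S := fun h => (hj j h).false
    rw [ordProd_insert_min x hj, mul_assoc, ih, mul_smul_comm, hx.mul_ordProd, smul_smul,
      Finset.insert_comm]
    congr 1
    by_cases hi : i ∈ S
    · simp [hi]
    rw [insCoeff_insert a hi, insCoeff_of_lt a hj]
    rcases lt_trichotomy i j with h | rfl | h
    · rw [if_neg hi, if_neg h.ne', if_pos h, if_neg (by simp [h.ne, hi]), Finset.filter_insert,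
        if_pos h, Finset.prod_insert (by simp [hjS])]
      ring
    · simp
    · rw [if_neg hi, if_neg h.ne, if_neg h.not_gt, if_neg (by simp [h.ne', hi]),
        Finset.filter_insert, if_neg h.not_gt]
      ring

/-- The coefficient that straightens `x (k 0) * ⋯ * x (k (r - 1))` into an increasing product: zero
if an index is repeated, otherwise one factor for each inversion of `k`. -/
def seqCoeff (a : ι → ι → K) {r : ℕ} (k : Fin r → ι) : K :=
  if Function.Injective k then
    ∏ p : Fin r × Fin r with p.1 < p.2 ∧ k p.2 < k p.1, a (k p.2) (k p.1) else 0

/-- The inversions of `k` are those that involve position `0` and those of the tail. -/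
lemma seqCoeff_succ (a : ι → ι → K) {r : ℕ} (k : Fin (r + 1) → ι) :
    seqCoeff a k = insCoeff a (k 0) (Finset.univ.image (Fin.tail k)) * seqCoeff a (Fin.tail k) := by
  have hinj : Function.Injective k ↔
      k 0 ∉ Finset.univ.image (Fin.tail k) ∧ Function.Injective (Fin.tail k) := by
    conv_lhs => rw [← Fin.cons_self_tail k, Fin.cons_injective_iff]
    simp
  unfold seqCoeff insCoeff
  by_cases h1 : k 0 ∈ Finset.univ.image (Fin.tail k)
  · rw [if_neg (by rw [hinj]; tauto), if_pos h1, zero_mul]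
  by_cases h2 : Function.Injective (Fin.tail k)
  · rw [if_pos (by rw [hinj]; tauto), if_neg h1, if_pos h2]
    simp only [Finset.prod_filter, Fintype.prod_prod_type]
    rw [Fin.prod_univ_succ, Finset.prod_image h2.injOn]
    congr 1
    · rw [Fin.prod_univ_succ]
      simp [Fin.tail]
      rfl
    · refine Finset.prod_congr rfl fun x _ => ?_
      rw [Fin.prod_univ_succ]
      simp [Fin.tail]
      rfl
  · rw [if_neg (by rw [hinj]; tauto), if_neg h2, mul_zero]

lemma IsTwistedExterior.prod_ofFn {a : ι → ι → K} {x : ι → A} (hx : IsTwistedExterior a x)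
    {r : ℕ} (k : Fin r → ι) :
    (List.ofFn fun i => x (k i)).prod = seqCoeff a k • ordProd x (Finset.univ.image k) := by
  induction r with
  | zero => simp [seqCoeff, ordProd, Function.injective_of_subsingleton]
  | succ r ih =>
    have him : Finset.univ.image k = insert (k 0) (Finset.univ.image (Fin.tail k)) := by
      ext i
      simp [Fin.exists_fin_succ, Fin.tail, eq_comm]
    rw [List.ofFn_succ, List.prod_cons, seqCoeff_succ, him]
    have := ih (Fin.tail k)
    simp only [Fin.tail] at this ⊢
    rw [this, mul_smul_comm, hx.mul_ordProd, smul_smul, mul_comm]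

lemma ordProd_image {r : ℕ} {J : Fin r → ι} (hJ : StrictMono J) (x : ι → A) :
    ordProd x (Finset.univ.image J) = (List.ofFn fun i => x (J i)).prod := by
  have : (Finset.univ.image J).sort (· ≤ ·) = List.ofFn J := by
    apply List.Perm.eq_of_pairwise (le := (· ≤ ·))
    · intro a b _ _ h1 h2; exact le_antisymm h1 h2
    · exact Finset.pairwise_sort _ _
    · exact (List.pairwise_ofFn.2 fun i j hij => (hJ hij).le)
    · rw [List.perm_ext_iff_of_nodup (Finset.sort_nodup _ _) (List.nodup_ofFn.2 hJ.injective)]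
      simp [List.mem_ofFn]
  rw [ordProd, this, List.map_ofFn]
  rfl

variable [Fintype ι]

/-- The creation operator `e_S ↦ insCoeff a i S • e_{S ∪ {i}}` on the space with basis the subsets
of `ι`, as a matrix. These operators are a concrete model of the twisted exterior algebra in which
the increasing products are visibly linearly independent. -/
def creation (a : ι → ι → K) (i : ι) : Matrix (Finset ι) (Finset ι) K :=
  Matrix.of fun T S => if T = insert i S then insCoeff a i S else 0

lemma mul_creation_apply (a : ι → ι → K) (i : ι) (X : Matrix (Finset ι) (Finset ι) K)
    (T S : Finset ι) : (X * creation a i) T S = X T (insert i S) * insCoeff a i S := by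
  simp [Matrix.mul_apply, creation]

lemma isTwistedExterior_creation (a : ι → ι → K) : IsTwistedExterior a (creation a) where
  sq i := by
    ext T S
    rw [mul_creation_apply]
    simp [creation, insCoeff]
  swap i j hij := by
    ext T S
    rw [Matrix.smul_apply, mul_creation_apply, mul_creation_apply]
    simp only [creation, Matrix.of_apply]
    rw [Finset.insert_comm]
    split_ifs with h
    · by_cases hi : i ∈ S
      · simp [hi, insCoeff]
      by_cases hj : j ∈ S
      · simp [hj, insCoeff]
      rw [insCoeff_insert a hi, insCoeff_insert a hj, if_neg hij.ne', if_pos hij, if_neg hij.ne,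
        if_neg hij.not_gt, smul_eq_mul]
      ring
    · simp

/-- Applied to the vacuum `e_∅`, the increasing product over `S` gives the basis vector `e_S`. Hence
the coefficient of the increasing product over `S` can be read off from the entry at `(S, ∅)`. -/
lemma ordProd_creation_apply_empty (a : ι → ι → K) (S T : Finset ι) :
    ordProd (creation a) S T ∅ = if T = S then 1 else 0 := by
  induction S using Finset.induction_on_min generalizing T with
  | empty => simp [Matrix.one_apply]
  | insert i S hi ih =>
    rw [ordProd_insert_min _ hi, Matrix.mul_apply]
    simp [ih, creation, insCoeff_of_lt a hi]

end Exterior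

/-! ### The FRT relations and the coaction on twisted exterior algebras -/

section FRT

variable {n : ℕ} {q : ℝ} {θ : Fin n → Fin n → ℂ} {B : Type*} [Ring B] [Algebra ℂ B]

lemma IsParam.mul_swap (hθ : IsParam θ) (i j : Fin n) : θ i j * θ j i = 1 := by
  rw [← hθ.conj_eq i j, Complex.mul_conj, Complex.normSq_eq_norm_sq, hθ.norm_eq_one]
  simp

lemma IsParam.ne_zero (hθ : IsParam θ) (i j : Fin n) : θ i j ≠ 0 :=
  left_ne_zero_of_mul_eq_one (hθ.mul_swap i j)

/-- Transposing `θ` is the same as conjugating it, so statements about columns for `θ` turn into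
statements about rows for the transposed parameters. -/
lemma IsParam.transpose (hθ : IsParam θ) : IsParam fun i j => θ j i where
  diag i := hθ.diag i
  norm_eq_one i j := hθ.norm_eq_one j i
  conj_eq i j := hθ.conj_eq j i

/-- The matrix `v` over `B` satisfies the FRT relations `R V₁ V₂ = V₂ V₁ R`, in the form in which
they occur among the defining relations. -/
def IsFRT (q : ℝ) (θ : Fin n → Fin n → ℂ) (v : Fin n → Fin n → B) : Prop :=
  ∀ i j r s, ∑ k, ∑ l, hayashiR q θ (j, i) (k, l) • (v k r * v l s) =
    ∑ k, ∑ l, hayashiR q θ (l, k) (r, s) • (v i k * v j l)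

lemma sum_hayashiR_row (q : ℝ) (θ : Fin n → Fin n → ℂ) {P : Type*} [AddCommGroup P] [Module ℂ P]
    (i j : Fin n) (f : Fin n → Fin n → P) :
    ∑ k, ∑ l, hayashiR q θ (j, i) (k, l) • f k l =
      (if i = j then (q : ℂ) else θ i j) • f j i +
        if i < j then ((q : ℂ) - (q : ℂ)⁻¹) • f i j else 0 := by
  have h : ∀ k l, hayashiR q θ (j, i) (k, l) • f k l =
      (if j = k then if i = l then (if i = j then (q : ℂ) else θ i j) • f k l else 0 else 0) +
      (if i = k then if j = l then
        (if i < j then ((q : ℂ) - (q : ℂ)⁻¹) • f k l else 0) else 0 else 0) := by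
    intro k l
    simp only [hayashiR, Matrix.of_apply, Prod.mk.injEq]
    by_cases h1 : j = k <;> by_cases h2 : i = l <;> by_cases h3 : i = k <;> by_cases h4 : j = l <;>
        simp_all [eq_comm]
  simp only [h, Finset.sum_add_distrib, Finset.sum_ite_eq, Finset.sum_ite_irrel,
    Finset.sum_const_zero, Finset.mem_univ, if_true]

lemma sum_hayashiR_col (q : ℝ) (θ : Fin n → Fin n → ℂ) {P : Type*} [AddCommGroup P] [Module ℂ P]
    (r s : Fin n) (f : Fin n → Fin n → P) :
    ∑ k, ∑ l, hayashiR q θ (l, k) (r, s) • f k l =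
      (if r = s then (q : ℂ) else θ s r) • f s r +
        if r < s then ((q : ℂ) - (q : ℂ)⁻¹) • f r s else 0 := by
  have h : ∀ k l, hayashiR q θ (l, k) (r, s) • f k l =
      (if s = k then if r = l then (if r = s then (q : ℂ) else θ s r) • f k l else 0 else 0) +
      (if r = k then if s = l then
        (if r < s then ((q : ℂ) - (q : ℂ)⁻¹) • f k l else 0) else 0 else 0) := by
    intro k l
    simp only [hayashiR, Matrix.of_apply, Prod.mk.injEq]
    by_cases h1 : s = k <;> by_cases h2 : r = l <;> by_cases h3 : r = k <;> by_cases h4 : s = l <;>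
        simp_all [eq_comm]
  simp only [h, Finset.sum_add_distrib, Finset.sum_ite_eq, Finset.sum_ite_irrel,
    Finset.sum_const_zero, Finset.mem_univ, if_true]

/-- The FRT relations with the entries of the `R`-matrix inserted: at most four terms survive. -/
lemma isFRT_iff {v : Fin n → Fin n → B} : IsFRT q θ v ↔ ∀ i j r s,
    (if i = j then (q : ℂ) else θ i j) • (v j r * v i s) +
        (if i < j then ((q : ℂ) - (q : ℂ)⁻¹) • (v i r * v j s) else 0) =
      (if r = s then (q : ℂ) else θ s r) • (v i s * v j r) +
        if r < s then ((q : ℂ) - (q : ℂ)⁻¹) • (v i r * v j s) else 0 := by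
  unfold IsFRT
  refine forall_congr' fun i => forall_congr' fun j => forall_congr' fun r =>
    forall_congr' fun s => ?_
  rw [sum_hayashiR_row q θ i j fun k l => v k r * v l s,
    sum_hayashiR_col q θ r s fun k l => v i k * v j l]

/-- The FRT relations are symmetric under transposing both `v` and `θ`: the two sides are
exchanged. -/
lemma IsFRT.transpose {v : Fin n → Fin n → B} (h : IsFRT q θ v) :
    IsFRT q (fun i j => θ j i) fun i j => v j i := by
  rw [isFRT_iff] at h ⊢
  intro i j r s
  exact (h r s i j).symm

/-- The factor `-q θ_{i,j}` that an inversion contributes to a quantum minor. -/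
def minorCoeff (q : ℝ) (θ : Fin n → Fin n → ℂ) (i j : Fin n) : ℂ := -(q : ℂ) * θ i j

variable {A : Type*} [Ring A] [Algebra ℂ A]

/-- The `r`-th column of `v` as a vector `∑ᵢ v_{i,r} ⊗ e_i` with coefficients in `B`. -/
def colVec (v : Fin n → Fin n → B) (e : Fin n → A) (r : Fin n) : B ⊗[ℂ] A := ∑ i, v i r ⊗ₜ[ℂ] e i

lemma sum_sum_eq_sum_lt {P : Type*} [AddCommGroup P] {f : Fin n → Fin n → P}
    (hf : ∀ i, f i i = 0) :
    ∑ i, ∑ j, f i j = ∑ i, ∑ j, if i < j then f i j + f j i else 0 := by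
  have h : ∀ i j, f i j = (if i < j then f i j else 0) + (if j < i then f i j else 0) := by
    intro i j
    rcases lt_trichotomy i j with h | rfl | h
    · simp [h, h.not_gt]
    · simp [hf]
    · simp [h, h.not_gt]
  calc ∑ i, ∑ j, f i j
      = ∑ i, ∑ j, (if i < j then f i j else 0) + ∑ i, ∑ j, (if j < i then f i j else 0) := by
        simp_rw [← Finset.sum_add_distrib, ← h]
    _ = ∑ i, ∑ j, (if i < j then f i j else 0) + ∑ i, ∑ j, (if i < j then f j i else 0) := by
        congr 1
        exact Finset.sum_comm
    _ = _ := by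
        simp_rw [← Finset.sum_add_distrib]
        refine Finset.sum_congr rfl fun i _ => Finset.sum_congr rfl fun j _ => ?_
        split_ifs <;> simp

/-- The product of two columns, with the terms for `(i, j)` and `(j, i)` collected. -/
lemma colVec_mul_colVec {v : Fin n → Fin n → B} {e : Fin n → A} {a : Fin n → Fin n → ℂ}
    (he : IsTwistedExterior a e) (r s : Fin n) :
    colVec v e r * colVec v e s = ∑ i, ∑ j,
      if i < j then (v i r * v j s + a i j • (v j r * v i s)) ⊗ₜ[ℂ] (e i * e j) else 0 := by
  simp only [colVec, Finset.sum_mul_sum, Algebra.TensorProduct.tmul_mul_tmul]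
  rw [sum_sum_eq_sum_lt fun i => by rw [he.sq, TensorProduct.tmul_zero]]
  refine Finset.sum_congr rfl fun i _ => Finset.sum_congr rfl fun j _ => ?_
  split_ifs with h
  · rw [he.swap i j h, TensorProduct.add_tmul, TensorProduct.tmul_smul, TensorProduct.smul_tmul']
  · rfl

/-- The comodule algebra property of the twisted exterior algebra: the columns of an FRT matrix
satisfy the same relations as the vectors `e_i`. -/
lemma IsFRT.isTwistedExterior_colVec (hq : q ≠ 0) (hθ : IsParam θ) {v : Fin n → Fin n → B}
    (hv : IsFRT q θ v) {e : Fin n → A} (he : IsTwistedExterior (minorCoeff q θ) e) :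
    IsTwistedExterior (minorCoeff q θ) (colVec v e) where
  sq r := by
    rw [colVec_mul_colVec he]
    refine Finset.sum_eq_zero fun i _ => Finset.sum_eq_zero fun j _ => ?_
    split_ifs with hij
    · have h := isFRT_iff.1 hv i j r r
      rw [if_neg hij.ne, if_pos hij, if_pos rfl, if_neg (lt_irrefl r), add_zero] at h
      have hq' : (q : ℂ) ≠ 0 := by exact_mod_cast hq
      have : v i r * v j r + minorCoeff q θ i j • (v j r * v i r) = 0 := by
        have h2 : θ i j • (v j r * v i r) = (q : ℂ)⁻¹ • (v i r * v j r) := by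
          rw [eq_sub_of_add_eq h]; module
        rw [minorCoeff, mul_smul, h2, smul_smul, neg_mul, mul_inv_cancel₀ hq']
        simp
      rw [this, TensorProduct.zero_tmul]
    · rfl
  swap r s hrs := by
    rw [colVec_mul_colVec he, colVec_mul_colVec he, Finset.smul_sum]
    refine Finset.sum_congr rfl fun i _ => ?_
    rw [Finset.smul_sum]
    refine Finset.sum_congr rfl fun j _ => ?_
    split_ifs with hij
    · rw [TensorProduct.smul_tmul']
      congr 1
      have h1 := isFRT_iff.1 hv i j r s
      have h2 := isFRT_iff.1 hv i j s r
      rw [if_neg hij.ne, if_pos hij, if_neg hrs.ne, if_pos hrs, add_left_inj] at h1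
      rw [if_neg hij.ne, if_pos hij, if_neg hrs.ne', if_neg hrs.not_gt, add_zero] at h2
      have hq' : (q : ℂ) ≠ 0 := by exact_mod_cast hq
      -- Express `v i s * v j r` and `v j s * v i r` through the two remaining products.
      have h3 : v i s * v j r = θ r s • θ i j • (v j r * v i s) := by
        rw [h1, smul_smul, hθ.mul_swap, one_smul]
      have h4 : θ i j • (v j s * v i r) = θ r s • (v i r * v j s) -
          ((q : ℂ) - (q : ℂ)⁻¹) • (v i s * v j r) := eq_sub_of_add_eq h2
      simp only [minorCoeff]
      rw [mul_smul _ (θ i j) (v j s * v i r), h4, h3]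
      match_scalars <;> field_simp
      ring
    · rw [smul_zero]

/-! ### Quantum minors as coefficients -/

/-- The coefficient of the basis vector `e_S` in the image of the vacuum vector `e_∅`. -/
def coeffAt (S : Finset (Fin n)) :
    B ⊗[ℂ] Matrix (Finset (Fin n)) (Finset (Fin n)) ℂ →ₗ[ℂ] B :=
  (TensorProduct.rid ℂ B).toLinearMap ∘ₗ
    (Matrix.entryLinearMap ℂ ℂ S ∅).lTensor B

@[simp] lemma coeffAt_tmul (S : Finset (Fin n)) (b : B)
    (X : Matrix (Finset (Fin n)) (Finset (Fin n)) ℂ) : coeffAt S (b ⊗ₜ[ℂ] X) = X S ∅ • b := by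
  simp [coeffAt]

lemma coeffAt_mul_tmul_one (S : Finset (Fin n))
    (X : B ⊗[ℂ] Matrix (Finset (Fin n)) (Finset (Fin n)) ℂ) (b : B) :
    coeffAt S (X * b ⊗ₜ[ℂ] 1) = coeffAt S X * b := by
  induction X with
  | zero => simp
  | tmul x y => simp
  | add x y hx hy => rw [add_mul, map_add, hx, hy, map_add, add_mul]

/-- Expansion of a product of columns, each summand being straightened. -/
lemma prod_ofFn_colVec (v : Fin n → Fin n → B) {e : Fin n → A} {a : Fin n → Fin n → ℂ}
    (he : IsTwistedExterior a e) {r : ℕ} (J : Fin r → Fin n) :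
    (List.ofFn fun x => colVec v e (J x)).prod = ∑ k : Fin r → Fin n,
      (seqCoeff a k • (List.ofFn fun x => v (k x) (J x)).prod) ⊗ₜ[ℂ]
        ordProd e (Finset.univ.image k) := by
  have h : ∀ k : Fin r → Fin n, (List.ofFn fun x => v (k x) (J x) ⊗ₜ[ℂ] e (k x)).prod =
      (List.ofFn fun x => v (k x) (J x)).prod ⊗ₜ[ℂ] (List.ofFn fun x => e (k x)).prod := by
    clear he
    induction r with
    | zero => simp [Algebra.TensorProduct.one_def]
    | succ r ih => intro k; simp [List.ofFn_succ, ih (fun x => J x.succ) (fun x => k x.succ)]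
  have := (MultilinearMap.mkPiAlgebraFin ℂ r (B ⊗[ℂ] A)).map_sum
    fun (x : Fin r) i => v i (J x) ⊗ₜ[ℂ] e i
  simp only [MultilinearMap.mkPiAlgebraFin_apply] at this
  simp only [colVec]
  rw [this]
  refine Finset.sum_congr rfl fun k _ => ?_
  rw [h, he.prod_ofFn, TensorProduct.tmul_smul, TensorProduct.smul_tmul']

/-- The coefficient of the increasing product over `S` in the product of the columns `J 0, J 1, …`:
a quantum minor whose rows are given by a set, and whose columns may come in any order, with
repetitions. -/
def minor (q : ℝ) (θ : Fin n → Fin n → ℂ) (v : Fin n → Fin n → B) (S : Finset (Fin n)) {r : ℕ}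
    (J : Fin r → Fin n) : B :=
  ∑ k : Fin r → Fin n with Finset.univ.image k = S,
    seqCoeff (minorCoeff q θ) k • (List.ofFn fun x => v (k x) (J x)).prod

lemma prod_ofFn_colVec_eq_sum_minor (v : Fin n → Fin n → B) {e : Fin n → A}
    (he : IsTwistedExterior (minorCoeff q θ) e) {r : ℕ} (J : Fin r → Fin n) :
    (List.ofFn fun x => colVec v e (J x)).prod =
      ∑ S, minor q θ v S J ⊗ₜ[ℂ] ordProd e S := by
  rw [prod_ofFn_colVec v he, ← Finset.sum_fiberwise (s := Finset.univ)
    (g := fun k : Fin r → Fin n => Finset.univ.image k)]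
  refine Finset.sum_congr rfl fun S _ => ?_
  rw [minor, TensorProduct.sum_tmul]
  refine Finset.sum_congr rfl fun k hk => ?_
  rw [(Finset.mem_filter.1 hk).2]

lemma coeffAt_prod_ofFn_colVec (v : Fin n → Fin n → B) (S : Finset (Fin n)) {r : ℕ}
    (J : Fin r → Fin n) :
    coeffAt S (List.ofFn fun x => colVec v (creation (minorCoeff q θ)) (J x)).prod =
      minor q θ v S J := by
  rw [prod_ofFn_colVec_eq_sum_minor v (isTwistedExterior_creation (minorCoeff q θ))]
  simp [ordProd_creation_apply_empty]

/-- The coefficient of the summand of `σ` in a quantum minor with rows `I`. -/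
def permCoeff (q : ℝ) (θ : Fin n → Fin n → ℂ) {r : ℕ} (I : Fin r → Fin n)
    (σ : Equiv.Perm (Fin r)) : ℂ :=
  ∏ p : Fin r × Fin r with p.1 < p.2 ∧ σ p.2 < σ p.1, minorCoeff q θ (I (σ p.2)) (I (σ p.1))

lemma seqCoeff_comp_perm {r : ℕ} {I : Fin r → Fin n} (hI : StrictMono I)
    (σ : Equiv.Perm (Fin r)) :
    seqCoeff (minorCoeff q θ) (I ∘ σ) = permCoeff q θ I σ := by
  rw [seqCoeff, if_pos (hI.injective.comp σ.injective), permCoeff]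
  simp [hI.lt_iff_lt]

/-- Only injective index sequences contribute to `minor`, and those with the image of `I` are the
`I ∘ σ`. -/
lemma minor_eq_qMinor (v : Fin n → Fin n → B) {r : ℕ} {I : Fin r → Fin n} (hI : StrictMono I)
    (J : Fin r → Fin n) : minor q θ v (Finset.univ.image I) J = qMinor q θ v I J := by
  symm
  unfold minor qMinor
  refine Finset.sum_of_injOn (fun σ => I ∘ σ) ?_ ?_ ?_ ?_
  · intro σ _ τ _ h
    ext x
    exact congrArg Fin.val (hI.injective (congrFun h x))
  · intro σ _
    simp only [Finset.coe_filter, Set.mem_ofPred_eq, Finset.mem_univ, true_and]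
    rw [← Finset.image_image, Finset.image_univ_equiv]
  · intro k hk hk'
    have him := (Finset.mem_filter.1 hk).2
    have : ¬ Function.Injective k := by
      intro hinj
      apply hk'
      have hex : ∀ x, ∃ y, I y = k x := fun x => by
        have : k x ∈ Finset.univ.image I := him ▸ Finset.mem_image_of_mem k (Finset.mem_univ x)
        simpa using this
      choose f hf using hex
      have hfi : Function.Injective f := fun x y h => hinj (by rw [← hf x, ← hf y, h])
      exact ⟨Equiv.ofBijective f (Finite.injective_iff_bijective.1 hfi), by simp,
        funext fun x => hf x⟩
    rw [seqCoeff, if_neg this, zero_smul]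
  · intro σ _
    rw [seqCoeff_comp_perm hI]
    rfl

end FRT

/-! ### Identities between quantum minors -/

section Minors

variable {n : ℕ} {q : ℝ} {θ : Fin n → Fin n → ℂ} {B : Type*} [Ring B] [Algebra ℂ B]

/-- Permuting the columns of a quantum minor multiplies it by the coefficient of the permutation. -/
lemma qMinor_comp_perm (hq : q ≠ 0) (hθ : IsParam θ) {v : Fin n → Fin n → B} (hv : IsFRT q θ v)
    {r : ℕ} {I J : Fin r → Fin n} (hI : StrictMono I) (hJ : StrictMono J)
    (τ : Equiv.Perm (Fin r)) :
    qMinor q θ v I (J ∘ τ) = permCoeff q θ J τ • qMinor q θ v I J := by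
  have hx := hv.isTwistedExterior_colVec hq hθ (isTwistedExterior_creation (minorCoeff q θ))
  rw [← minor_eq_qMinor v hI, ← minor_eq_qMinor v hI, ← coeffAt_prod_ofFn_colVec,
    ← coeffAt_prod_ofFn_colVec, hx.prod_ofFn (J ∘ τ), seqCoeff_comp_perm hJ, map_smul,
    ← Finset.image_image, Finset.image_univ_equiv, ordProd_image hJ]

/-- The expansion of a quantum minor by rows agrees with the one by columns. Summing the monomials
`v_{I(σ x), J(τ x)}` over both `σ` and `τ` with the coefficients of both expansions gives the one
minor or the other, each times `s = ∑_σ q ^ (2 ℓ(σ))`, where `ℓ` counts inversions; and `s > 0`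
because `q` is real and nonzero. -/
lemma qMinor_transpose (hq : q ≠ 0) (hθ : IsParam θ) {v : Fin n → Fin n → B} (hv : IsFRT q θ v)
    {r : ℕ} {I J : Fin r → Fin n} (hI : StrictMono I) (hJ : StrictMono J) :
    qMinor q (fun i j => θ j i) (fun i j => v j i) J I = qMinor q θ v I J := by
  have hc : ∀ (I : Fin r → Fin n) (σ : Equiv.Perm (Fin r)),
      permCoeff q (fun i j => θ j i) I σ * permCoeff q θ I σ =
        ((∏ p : Fin r × Fin r with p.1 < p.2 ∧ σ p.2 < σ p.1, q ^ 2 : ℝ) : ℂ) := by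
    intro I σ
    rw [permCoeff, permCoeff, ← Finset.prod_mul_distrib, Complex.ofReal_prod]
    refine Finset.prod_congr rfl fun p _ => ?_
    simp only [minorCoeff]
    linear_combination (q : ℂ) ^ 2 * hθ.mul_swap (I (σ p.2)) (I (σ p.1)) +
      (Complex.ofReal_pow q 2).symm
  set s : ℝ := ∑ σ : Equiv.Perm (Fin r),
    ∏ p : Fin r × Fin r with p.1 < p.2 ∧ σ p.2 < σ p.1, q ^ 2 with hs
  have hs0 : 0 < s := by
    refine Finset.sum_pos (fun σ _ => Finset.prod_pos fun p _ => by positivity) ?_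
    exact Finset.univ_nonempty
  -- The double sum is evaluated by summing over `σ` first, and then in the other order.
  have h1 : ∑ τ, permCoeff q (fun i j => θ j i) J τ • qMinor q θ v I (J ∘ τ) =
      (s : ℂ) • qMinor q θ v I J := by
    simp_rw [qMinor_comp_perm hq hθ hv hI hJ, smul_smul, hc, ← Finset.sum_smul, hs,
      Complex.ofReal_sum]
  have h2 : ∑ σ, permCoeff q θ I σ •
      qMinor q (fun i j => θ j i) (fun i j => v j i) J (I ∘ σ) =
      (s : ℂ) • qMinor q (fun i j => θ j i) (fun i j => v j i) J I := by
    simp_rw [qMinor_comp_perm hq hθ.transpose hv.transpose hJ hI, smul_smul,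
      mul_comm (permCoeff q θ I _), hc, ← Finset.sum_smul, hs, Complex.ofReal_sum]
  have h3 : ∑ τ, permCoeff q (fun i j => θ j i) J τ • qMinor q θ v I (J ∘ τ) =
      ∑ σ, permCoeff q θ I σ •
        qMinor q (fun i j => θ j i) (fun i j => v j i) J (I ∘ σ) := by
    simp only [qMinor, Finset.smul_sum]
    rw [Finset.sum_comm]
    refine Finset.sum_congr rfl fun σ _ => Finset.sum_congr rfl fun τ _ => ?_
    exact smul_comm _ _ _
  rw [h1, h2] at h3
  exact (smul_right_injective B (by exact_mod_cast hs0.ne' : (s : ℂ) ≠ 0) h3).symm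

lemma omit1_strictMono (k : Fin n) : StrictMono (omit1 k) :=
  (Finset.orderEmbOfFin _ _).strictMono

lemma image_omit1 (k : Fin n) : Finset.univ.image (omit1 k) = {k}ᶜ :=
  Finset.image_orderEmbOfFin_univ _ _

lemma qDet_transpose (hq : q ≠ 0) (hθ : IsParam θ) {v : Fin n → Fin n → B} (hv : IsFRT q θ v) :
    qDet q (fun i j => θ j i) (fun i j => v j i) = qDet q θ v :=
  qMinor_transpose hq hθ hv strictMono_id strictMono_id

lemma qCofactor_transpose (hq : q ≠ 0) (hθ : IsParam θ) {v : Fin n → Fin n → B}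
    (hv : IsFRT q θ v) (i k : Fin n) :
    qCofactor q (fun i j => θ j i) (fun i j => v j i) k i = qCofactor q θ v i k :=
  qMinor_transpose hq hθ hv (omit1_strictMono i) (omit1_strictMono k)

lemma coeffAt_ordProd_univ (v : Fin n → Fin n → B) :
    coeffAt Finset.univ (ordProd (colVec v (creation (minorCoeff q θ))) Finset.univ) =
      qDet q θ v := by
  have h1 : (Finset.univ : Finset (Fin n)) = Finset.univ.image id := Finset.image_id.symm
  rw [h1, ordProd_image strictMono_id, coeffAt_prod_ofFn_colVec, minor_eq_qMinor v strictMono_id]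
  rfl

lemma ordProd_colVec_compl (v : Fin n → Fin n → B) {A : Type*} [Ring A] [Algebra ℂ A]
    {e : Fin n → A} (he : IsTwistedExterior (minorCoeff q θ) e) (k : Fin n) :
    ordProd (colVec v e) {k}ᶜ = ∑ S, minor q θ v S (omit1 k) ⊗ₜ[ℂ] ordProd e S := by
  rw [← image_omit1, ordProd_image (omit1_strictMono k), prod_ofFn_colVec_eq_sum_minor v he]

lemma minor_compl_omit1 (v : Fin n → Fin n → B) (i k : Fin n) :
    minor q θ v {i}ᶜ (omit1 k) = qCofactor q θ v i k := by
  rw [← image_omit1, minor_eq_qMinor v (omit1_strictMono i)]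
  rfl

lemma insert_eq_univ_iff {i : Fin n} {S : Finset (Fin n)} (hi : i ∉ S) :
    Finset.univ = insert i S ↔ S = {i}ᶜ := by
  constructor
  · intro h
    ext j
    have : j ∈ insert i S := h ▸ Finset.mem_univ j
    simp only [Finset.mem_insert] at this
    simp only [Finset.mem_compl, Finset.mem_singleton]
    constructor
    · rintro hj rfl; exact hi hj
    · tauto
  · rintro rfl
    ext j
    simp

/-- Laplace expansion along a column, read off from the product of all columns but the `k`-th with
the `j`-th one on its right. -/
lemma sum_qCofactor_mul (hq : q ≠ 0) (hθ : IsParam θ) {v : Fin n → Fin n → B}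
    (hv : IsFRT q θ v) (j k : Fin n) :
    ∑ i, (∏ l ∈ Finset.Ioi i, minorCoeff q θ i l) • (qCofactor q θ v i k * v i j) =
      if j = k then (∏ l ∈ Finset.Ioi k, minorCoeff q θ k l) • qDet q θ v else 0 := by
  have hE := isTwistedExterior_creation (minorCoeff q θ)
  have hx := hv.isTwistedExterior_colVec hq hθ hE
  have hset : ∀ i : Fin n, (({i}ᶜ : Finset (Fin n)).filter fun l => i < l) = Finset.Ioi i := by
    intro i; ext l
    simp only [Finset.mem_filter, Finset.mem_compl, Finset.mem_singleton, Finset.mem_Ioi]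
    exact ⟨fun h => h.2, fun h => ⟨h.ne', h⟩⟩
  have key := congrArg (coeffAt Finset.univ) (hx.ordProd_mul j {k}ᶜ)
  have hR : coeffAt Finset.univ ((if j ∈ ({k}ᶜ : Finset (Fin n)) then 0 else
      ∏ l ∈ ({k}ᶜ : Finset (Fin n)) with j < l, minorCoeff q θ j l) •
        ordProd (colVec v (creation (minorCoeff q θ))) (insert j {k}ᶜ)) =
      if j = k then (∏ l ∈ Finset.Ioi k, minorCoeff q θ k l) • qDet q θ v else 0 := by
    by_cases hjk : j = k
    · subst hjk
      rw [if_neg (by simp), if_pos rfl, map_smul, hset,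
        ← (insert_eq_univ_iff (by simp : j ∉ ({j}ᶜ : Finset (Fin n)))).2 rfl, coeffAt_ordProd_univ]
    · simp [hjk]
  rw [hR] at key
  rw [← key, ordProd_colVec_compl v hE, colVec, Finset.sum_mul_sum]
  simp only [map_sum]
  rw [Finset.sum_comm]
  refine Finset.sum_congr rfl fun i _ => ?_
  simp only [Algebra.TensorProduct.tmul_mul_tmul, coeffAt_tmul, hE.ordProd_mul, Matrix.smul_apply,
    ordProd_creation_apply_empty]
  rw [Finset.sum_eq_single {i}ᶜ]
  · rw [if_pos ((insert_eq_univ_iff (by simp)).2 rfl), if_neg (by simp), hset, minor_compl_omit1,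
      smul_eq_mul, mul_one]
  · intro S _ hS
    by_cases hi : i ∈ S
    · simp [hi]
    · rw [if_neg (mt (insert_eq_univ_iff hi).1 hS)]; simp
  · simp

/-- Laplace expansion along a column, read off from the product of all columns but the `k`-th with
the `j`-th one on its left. -/
lemma sum_mul_qCofactor (hq : q ≠ 0) (hθ : IsParam θ) {v : Fin n → Fin n → B}
    (hv : IsFRT q θ v) (j k : Fin n) :
    ∑ i, (∏ l ∈ Finset.Iio i, minorCoeff q θ l i) • (v i j * qCofactor q θ v i k) =
      if j = k then (∏ l ∈ Finset.Iio k, minorCoeff q θ l k) • qDet q θ v else 0 := by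
  have hE := isTwistedExterior_creation (minorCoeff q θ)
  have hx := hv.isTwistedExterior_colVec hq hθ hE
  have hset : ∀ i : Fin n, insCoeff (minorCoeff q θ) i {i}ᶜ =
      ∏ l ∈ Finset.Iio i, minorCoeff q θ l i := by
    intro i
    rw [insCoeff, if_neg (by simp)]
    congr 1
    ext l
    simp only [Finset.mem_filter, Finset.mem_compl, Finset.mem_singleton, Finset.mem_Iio]
    exact ⟨fun h => h.2, fun h => ⟨h.ne, h⟩⟩
  have key := congrArg (coeffAt Finset.univ) (hx.mul_ordProd j {k}ᶜ)
  have hR : coeffAt Finset.univ (insCoeff (minorCoeff q θ) j {k}ᶜ •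
        ordProd (colVec v (creation (minorCoeff q θ))) (insert j {k}ᶜ)) =
      if j = k then (∏ l ∈ Finset.Iio k, minorCoeff q θ l k) • qDet q θ v else 0 := by
    by_cases hjk : j = k
    · subst hjk
      rw [if_pos rfl, map_smul, hset,
        ← (insert_eq_univ_iff (by simp : j ∉ ({j}ᶜ : Finset (Fin n)))).2 rfl, coeffAt_ordProd_univ]
    · simp [hjk, insCoeff]
  rw [hR] at key
  rw [← key, ordProd_colVec_compl v hE, colVec, Finset.sum_mul_sum, map_sum]
  refine Finset.sum_congr rfl fun i _ => ?_
  rw [map_sum]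
  simp only [Algebra.TensorProduct.tmul_mul_tmul, coeffAt_tmul, hE.mul_ordProd, Matrix.smul_apply,
    ordProd_creation_apply_empty]
  rw [Finset.sum_eq_single {i}ᶜ]
  · rw [if_pos ((insert_eq_univ_iff (by simp)).2 rfl), hset, minor_compl_omit1,
      smul_eq_mul, mul_one]
  · intro S _ hS
    by_cases hi : i ∈ S
    · simp [hi, insCoeff]
    · rw [if_neg (mt (insert_eq_univ_iff hi).1 hS)]; simp
  · simp

/-- Laplace expansion along a row, the complementary minors on the left. -/
lemma sum_qCofactor_mul_row (hq : q ≠ 0) (hθ : IsParam θ) {v : Fin n → Fin n → B}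
    (hv : IsFRT q θ v) (j k : Fin n) :
    ∑ i, (∏ l ∈ Finset.Ioi i, minorCoeff q θ l i) • (qCofactor q θ v k i * v j i) =
      if j = k then (∏ l ∈ Finset.Ioi k, minorCoeff q θ l k) • qDet q θ v else 0 := by
  have := sum_qCofactor_mul hq hθ.transpose hv.transpose j k
  simp only [qCofactor_transpose hq hθ hv, qDet_transpose hq hθ hv] at this
  exact this

/-- Laplace expansion along a row, the complementary minors on the right. -/
lemma sum_mul_qCofactor_row (hq : q ≠ 0) (hθ : IsParam θ) {v : Fin n → Fin n → B}
    (hv : IsFRT q θ v) (j k : Fin n) :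
    ∑ i, (∏ l ∈ Finset.Iio i, minorCoeff q θ i l) • (v j i * qCofactor q θ v k i) =
      if j = k then (∏ l ∈ Finset.Iio k, minorCoeff q θ k l) • qDet q θ v else 0 := by
  have := sum_mul_qCofactor hq hθ.transpose hv.transpose j k
  simp only [qCofactor_transpose hq hθ hv, qDet_transpose hq hθ hv] at this
  exact this

/-- The sum may be taken over all self-maps, since `seqCoeff` vanishes on those with repetitions. -/
lemma qDet_eq_sum (v : Fin n → Fin n → B) :
    qDet q θ v = ∑ k : Fin n → Fin n,
      seqCoeff (minorCoeff q θ) k • (List.ofFn fun x => v (k x) x).prod := by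
  have h := minor_eq_qMinor (q := q) (θ := θ) v strictMono_id id
  rw [qDet, ← h, minor, Finset.sum_filter]
  refine Finset.sum_congr rfl fun k _ => ?_
  split_ifs with hk
  · rfl
  · rw [Finset.image_id] at hk
    rw [seqCoeff, if_neg, zero_smul]
    intro hinj
    exact hk (Finset.image_univ_of_surjective (Finite.injective_iff_surjective.1 hinj))

lemma prod_ofFn_eq_smul_ordProd_univ {A : Type*} [Ring A] [Algebra ℂ A] {x : Fin n → A}
    {a : Fin n → Fin n → ℂ} (hx : IsTwistedExterior a x) (k : Fin n → Fin n) :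
    (List.ofFn fun i => x (k i)).prod = seqCoeff a k • ordProd x Finset.univ := by
  rw [hx.prod_ofFn]
  by_cases hk : Function.Injective k
  · rw [Finset.image_univ_of_surjective (Finite.injective_iff_surjective.1 hk)]
  · rw [seqCoeff, if_neg hk, zero_smul, zero_smul]

lemma prod_ofFn_mul_of_commute {C : Type*} [Monoid C] {r : ℕ} (f g : Fin r → C)
    (h : ∀ i j, Commute (g i) (f j)) :
    (List.ofFn fun i => f i * g i).prod = (List.ofFn f).prod * (List.ofFn g).prod := by
  induction r with
  | zero => simp
  | succ r ih =>
    rw [List.ofFn_succ, List.prod_cons, ih _ _ fun i j => h i.succ j.succ, List.ofFn_succ,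
      List.prod_cons, List.ofFn_succ, List.prod_cons]
    have : Commute (g 0) (List.ofFn fun i => f i.succ).prod := by
      refine Commute.list_prod_right _ _ fun y hy => ?_
      obtain ⟨i, rfl⟩ := (List.mem_ofFn' _ _).1 hy
      exact h 0 i.succ
    rw [mul_assoc, ← mul_assoc (g 0), this.eq]
    simp only [mul_assoc]

/-- The quantum determinant is multiplicative for an FRT matrix `v` and a matrix `w` whose entries
commute with those of `v`: the product of the columns of `v w` is a combination of products of
columns of `v`, and straightening these produces exactly the coefficients in `qDet q θ w`. -/
lemma qDet_mul (hq : q ≠ 0) (hθ : IsParam θ) {v w : Fin n → Fin n → B} (hv : IsFRT q θ v)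
    (hvw : ∀ i j k l, Commute (v i j) (w k l)) :
    qDet q θ (fun i j => ∑ k, v i k * w k j) = qDet q θ v * qDet q θ w := by
  have hx := hv.isTwistedExterior_colVec hq hθ (isTwistedExterior_creation (minorCoeff q θ))
  set x := colVec v (creation (minorCoeff q θ)) with hxdef
  have h1 : ∀ r, colVec (fun i j => ∑ k, v i k * w k j) (creation (minorCoeff q θ)) r =
      ∑ k, x k * w k r ⊗ₜ[ℂ] 1 := by
    intro r
    simp only [hxdef, colVec, TensorProduct.sum_tmul, Finset.sum_mul,
      Algebra.TensorProduct.tmul_mul_tmul, mul_one]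
    exact Finset.sum_comm
  have h2 : (List.ofFn fun r =>
      colVec (fun i j => ∑ k, v i k * w k j) (creation (minorCoeff q θ)) r).prod =
      ordProd x Finset.univ * qDet q θ w ⊗ₜ[ℂ] 1 := by
    have := (MultilinearMap.mkPiAlgebraFin ℂ n
      (B ⊗[ℂ] Matrix (Finset (Fin n)) (Finset (Fin n)) ℂ)).map_sum
        fun (r : Fin n) k => x k * w k r ⊗ₜ[ℂ] 1
    simp only [MultilinearMap.mkPiAlgebraFin_apply] at this
    simp only [h1]
    rw [this, qDet_eq_sum, TensorProduct.sum_tmul, Finset.mul_sum]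
    refine Finset.sum_congr rfl fun k _ => ?_
    have h3 : ∀ (b : Fin n → B), (List.ofFn fun r => b r ⊗ₜ[ℂ]
        (1 : Matrix (Finset (Fin n)) (Finset (Fin n)) ℂ)).prod = (List.ofFn b).prod ⊗ₜ[ℂ] 1 := by
      intro b
      have := map_list_prod (Algebra.TensorProduct.includeLeft :
        B →ₐ[ℂ] B ⊗[ℂ] Matrix (Finset (Fin n)) (Finset (Fin n)) ℂ) (List.ofFn b)
      simpa [List.map_ofFn, Function.comp_def] using this.symm
    rw [prod_ofFn_mul_of_commute (fun r => x (k r)), prod_ofFn_eq_smul_ordProd_univ hx, h3,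
      ← TensorProduct.smul_tmul', smul_mul_assoc, mul_smul_comm]
    intro r s
    rw [hxdef, colVec]
    refine Commute.sum_right _ _ _ fun i _ => ?_
    rw [commute_iff_eq, Algebra.TensorProduct.tmul_mul_tmul, Algebra.TensorProduct.tmul_mul_tmul,
      mul_one, one_mul, (hvw _ _ _ _).eq]
  have h4 : (List.ofFn fun r =>
      colVec (fun i j => ∑ k, v i k * w k j) (creation (minorCoeff q θ)) r).prod =
      ordProd (colVec (fun i j => ∑ k, v i k * w k j) (creation (minorCoeff q θ)))
        Finset.univ := by
    have := ordProd_image strictMono_id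
      (colVec (fun i j => ∑ k, v i k * w k j) (creation (minorCoeff q θ)))
    rw [Finset.image_id] at this
    exact this.symm
  rw [← coeffAt_ordProd_univ, ← h4, h2, coeffAt_mul_tmul_one, coeffAt_ordProd_univ]

lemma qDet_one :
    qDet q θ (fun i j => if i = j then (1 : B) else 0) = 1 := by
  have h1 : colVec (fun i j => if i = j then (1 : B) else 0) (creation (minorCoeff q θ)) =
      fun r => (Algebra.TensorProduct.includeRight :
        _ →ₐ[ℂ] B ⊗[ℂ] Matrix (Finset (Fin n)) (Finset (Fin n)) ℂ)
          (creation (minorCoeff q θ) r) := by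
    ext r
    simp only [colVec, Algebra.TensorProduct.includeRight_apply]
    rw [Finset.sum_eq_single r (fun i _ hi => by rw [if_neg hi, TensorProduct.zero_tmul])
      (by simp), if_pos rfl]
  rw [← coeffAt_ordProd_univ, h1, ordProd, ← Function.comp_def, ← List.map_map, ← map_list_prod]
  change coeffAt _ (Algebra.TensorProduct.includeRight
    (ordProd (creation (minorCoeff q θ)) Finset.univ)) = 1
  rw [Algebra.TensorProduct.includeRight_apply, coeffAt_tmul, ordProd_creation_apply_empty,
    if_pos rfl, one_smul]

/-- If `t` is a right inverse of `v`, then the quantum determinant of `t` in the opposite algebra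
is a right inverse of that of `v`. In the sum of the `ξ_{k 1} ⋯ ξ_{k n} t_{k n, n} ⋯ t_{k 1, 1}`,
where `ξ_k` are the columns of `v`, the innermost factors contract successively to the vectors
`e_n, …, e_1`; straightening the `ξ` instead gives `ξ_1 ⋯ ξ_n` times the determinant of `t`. -/
lemma qDet_mul_unop_qDet_op (hq : q ≠ 0) (hθ : IsParam θ) {v t : Fin n → Fin n → B}
    (hv : IsFRT q θ v) (hvt : ∀ i j, ∑ k, v i k * t k j = if i = j then 1 else 0) :
    qDet q θ v * (qDet q θ fun i j => MulOpposite.op (t i j)).unop = 1 := by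
  have hE := isTwistedExterior_creation (minorCoeff q θ)
  have hx := hv.isTwistedExterior_colVec hq hθ hE
  set x := colVec v (creation (minorCoeff q θ)) with hxdef
  let E : Fin n → B ⊗[ℂ] Matrix (Finset (Fin n)) (Finset (Fin n)) ℂ :=
    fun i => 1 ⊗ₜ creation (minorCoeff q θ) i
  have hxt : ∀ r, ∑ k, x k * t k r ⊗ₜ[ℂ] 1 = E r := by
    intro r
    simp only [hxdef, colVec, Finset.sum_mul, Algebra.TensorProduct.tmul_mul_tmul, mul_one]
    rw [Finset.sum_comm]
    simp_rw [← TensorProduct.sum_tmul, hvt]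
    rw [Finset.sum_eq_single r (fun i _ hi => by rw [if_neg hi, TensorProduct.zero_tmul])
      (by simp), if_pos rfl]
  have hcomm : ∀ (b : B) {r : ℕ} (c : Fin r → Fin n),
      Commute ((List.ofFn fun i => E (c i)).prod) (b ⊗ₜ[ℂ] 1) := by
    intro b r c
    refine Commute.list_prod_left _ _ fun y hy => ?_
    obtain ⟨i, rfl⟩ := (List.mem_ofFn' _ _).1 hy
    rw [commute_iff_eq, Algebra.TensorProduct.tmul_mul_tmul, Algebra.TensorProduct.tmul_mul_tmul,
      mul_one, one_mul, mul_one, one_mul]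
  have key : ∀ {r : ℕ} (c : Fin r → Fin n), ∑ k : Fin r → Fin n,
      (List.ofFn fun i => x (k i)).prod *
        (List.ofFn fun i => t (k i) (c i)).reverse.prod ⊗ₜ[ℂ] 1 =
      (List.ofFn fun i => E (c i)).prod := by
    intro r
    induction r with
    | zero => intro c; simp [← Algebra.TensorProduct.one_def]
    | succ r ih =>
      intro c
      rw [← (Fin.consEquiv fun _ => Fin n).sum_comp, Fintype.sum_prod_type]
      simp only [Fin.consEquiv_apply, List.ofFn_succ, Fin.cons_zero, Fin.cons_succ,
        List.prod_cons, List.reverse_cons, List.prod_append, List.prod_nil,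
        mul_one]
      have : ∀ k0, ∑ k : Fin r → Fin n, x k0 * (List.ofFn fun i => x (k i)).prod *
          ((List.ofFn fun i => t (k i) (c i.succ)).reverse.prod * t k0 (c 0)) ⊗ₜ[ℂ] 1 =
          x k0 * t k0 (c 0) ⊗ₜ[ℂ] 1 * (List.ofFn fun i => E (c (Fin.succ i))).prod := by
        intro k0
        rw [mul_assoc, ← (hcomm _ _).eq, ← ih, Finset.sum_mul, Finset.mul_sum]
        refine Finset.sum_congr rfl fun k _ => ?_
        rw [mul_assoc, mul_assoc, Algebra.TensorProduct.tmul_mul_tmul, one_mul]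
      simp only [this]
      rw [← Finset.sum_mul, hxt]
  have h1 : ordProd x Finset.univ *
      (qDet q θ fun i j => MulOpposite.op (t i j)).unop ⊗ₜ[ℂ] 1 =
      (List.ofFn fun i => E i).prod := by
    have := key (id : Fin n → Fin n)
    simp only [id] at this
    rw [← this, qDet_eq_sum, Finset.unop_sum, TensorProduct.sum_tmul, Finset.mul_sum]
    refine Finset.sum_congr rfl fun k _ => ?_
    rw [prod_ofFn_eq_smul_ordProd_univ hx, MulOpposite.unop_smul, MulOpposite.unop_list_prod,
      List.map_ofFn, ← TensorProduct.smul_tmul', mul_smul_comm, smul_mul_assoc]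
    rfl
  have h2 : coeffAt Finset.univ (List.ofFn fun i => E i).prod = (1 : B) := by
    have h3 : (List.ofFn fun i => E i).prod =
        1 ⊗ₜ ordProd (creation (minorCoeff q θ)) (Finset.univ.image id) := by
      rw [ordProd_image strictMono_id, ← Algebra.TensorProduct.includeRight_apply, map_list_prod,
        List.map_ofFn]
      rfl
    rw [h3, coeffAt_tmul, ordProd_creation_apply_empty, Finset.image_id, if_pos rfl, one_smul]
  rw [← h1, coeffAt_mul_tmul_one, coeffAt_ordProd_univ] at h2
  exact h2

end Minors

/-! ### Products and inverses of FRT matrices -/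

section Legs

variable {n : ℕ} {q : ℝ} {θ : Fin n → Fin n → ℂ} {B : Type*} [Ring B]

/-- The matrix `v ⊗ 1`, that is `V₁`. -/
def leg1 (v : Matrix (Fin n) (Fin n) B) : Matrix (Fin n × Fin n) (Fin n × Fin n) B :=
  Matrix.of fun x y => if x.2 = y.2 then v x.1 y.1 else 0

/-- The matrix `1 ⊗ v`, that is `V₂`. -/
def leg2 (v : Matrix (Fin n) (Fin n) B) : Matrix (Fin n × Fin n) (Fin n × Fin n) B :=
  Matrix.of fun x y => if x.1 = y.1 then v x.2 y.2 else 0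

lemma leg1_mul_leg2_apply (v w : Matrix (Fin n) (Fin n) B) (x y : Fin n × Fin n) :
    (leg1 v * leg2 w) x y = v x.1 y.1 * w x.2 y.2 := by
  simp [Matrix.mul_apply, Fintype.sum_prod_type, leg1, leg2]

lemma leg2_mul_leg1_apply (v w : Matrix (Fin n) (Fin n) B) (x y : Fin n × Fin n) :
    (leg2 w * leg1 v) x y = w x.2 y.2 * v x.1 y.1 := by
  simp [Matrix.mul_apply, Fintype.sum_prod_type, leg1, leg2]

lemma leg1_mul (v w : Matrix (Fin n) (Fin n) B) : leg1 (v * w) = leg1 v * leg1 w := by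
  ext x y
  simp [Matrix.mul_apply, Fintype.sum_prod_type, leg1, Finset.sum_ite_irrel]

lemma leg2_mul (v w : Matrix (Fin n) (Fin n) B) : leg2 (v * w) = leg2 v * leg2 w := by
  ext x y
  simp [Matrix.mul_apply, Fintype.sum_prod_type, leg2, Finset.sum_ite_irrel]

lemma leg1_one : leg1 (1 : Matrix (Fin n) (Fin n) B) = 1 := by
  ext x y
  simp only [leg1, Matrix.of_apply, Matrix.one_apply, Prod.ext_iff]
  split_ifs <;> simp_all

lemma leg2_one : leg2 (1 : Matrix (Fin n) (Fin n) B) = 1 := by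
  ext x y
  simp only [leg2, Matrix.of_apply, Matrix.one_apply, Prod.ext_iff]
  split_ifs <;> simp_all

variable [Algebra ℂ B]

lemma map_hayashiR_mul_apply (X : Matrix (Fin n × Fin n) (Fin n × Fin n) B) (x y : Fin n × Fin n) :
    ((hayashiR q θ).map (algebraMap ℂ B) * X) x y =
      ∑ k, ∑ l, hayashiR q θ x (k, l) • X (k, l) y := by
  simp [Matrix.mul_apply, Fintype.sum_prod_type, Algebra.smul_def]

lemma mul_map_hayashiR_apply (X : Matrix (Fin n × Fin n) (Fin n × Fin n) B) (x y : Fin n × Fin n) :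
    (X * (hayashiR q θ).map (algebraMap ℂ B)) x y =
      ∑ k, ∑ l, hayashiR q θ (l, k) y • X x (l, k) := by
  simp only [Matrix.mul_apply, Fintype.sum_prod_type, Algebra.smul_def, Matrix.map_apply,
    Algebra.commutes]
  exact Finset.sum_comm

/-- The FRT relations as the matrix identity `R V₁ V₂ = V₂ V₁ R`. -/
lemma isFRT_iff_legs {v : Matrix (Fin n) (Fin n) B} :
    IsFRT q θ v ↔ (hayashiR q θ).map (algebraMap ℂ B) * (leg1 v * leg2 v) =
      leg2 v * leg1 v * (hayashiR q θ).map (algebraMap ℂ B) := by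
  rw [← Matrix.ext_iff]
  simp only [Prod.forall, map_hayashiR_mul_apply, mul_map_hayashiR_apply, leg1_mul_leg2_apply,
    leg2_mul_leg1_apply, IsFRT]
  exact ⟨fun h a b c d => h b a c d, fun h a b c d => h b a c d⟩

/-- The FRT relations in the opposite algebra: the products of entries are reversed, while `R` stays
on its side. -/
lemma isFRT_op_iff_legs {t : Matrix (Fin n) (Fin n) B} :
    IsFRT q θ (fun i j => MulOpposite.op (t i j)) ↔
      (hayashiR q θ).map (algebraMap ℂ B) * (leg2 t * leg1 t) =
      leg1 t * leg2 t * (hayashiR q θ).map (algebraMap ℂ B) := by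
  rw [← Matrix.ext_iff]
  simp only [Prod.forall, map_hayashiR_mul_apply, mul_map_hayashiR_apply, leg1_mul_leg2_apply,
    leg2_mul_leg1_apply, IsFRT, ← MulOpposite.op_mul, ← MulOpposite.op_smul, ← Finset.op_sum,
    MulOpposite.op_inj]
  exact ⟨fun h a b c d => h b a c d, fun h a b c d => h b a c d⟩

lemma isFRT_one : IsFRT q θ (fun i j => if i = j then (1 : B) else 0) := by
  have : (fun i j => if i = j then (1 : B) else 0) = (1 : Matrix (Fin n) (Fin n) B) := by
    ext i j; rw [Matrix.one_apply]
  rw [this, isFRT_iff_legs, leg1_one, leg2_one]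
  simp

lemma IsFRT.mul {v w : Fin n → Fin n → B} (hv : IsFRT q θ v) (hw : IsFRT q θ w)
    (hvw : ∀ i j k l, Commute (v i j) (w k l)) :
    IsFRT q θ (fun i j => ∑ k, v i k * w k j) := by
  let v' : Matrix (Fin n) (Fin n) B := Matrix.of v
  let w' : Matrix (Fin n) (Fin n) B := Matrix.of w
  have hv' : IsFRT q θ v' := hv
  have hw' : IsFRT q θ w' := hw
  have : (fun i j => ∑ k, v i k * w k j) = v' * w' := by
    ext i j; rw [Matrix.mul_apply]; rfl
  rw [this]
  rw [isFRT_iff_legs] at *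
  have h1 : leg1 w' * leg2 v' = leg2 v' * leg1 w' := by
    ext x y
    rw [leg1_mul_leg2_apply, leg2_mul_leg1_apply]
    exact (hvw _ _ _ _).symm.eq
  have h2 : leg1 v' * leg2 w' = leg2 w' * leg1 v' := by
    ext x y
    rw [leg1_mul_leg2_apply, leg2_mul_leg1_apply]
    exact (hvw _ _ _ _).eq
  set R := (hayashiR q θ).map (algebraMap ℂ B)
  rw [leg1_mul, leg2_mul]
  calc R * (leg1 v' * leg1 w' * (leg2 v' * leg2 w'))
      = R * (leg1 v' * (leg1 w' * leg2 v') * leg2 w') := by noncomm_ring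
    _ = R * (leg1 v' * leg2 v') * (leg1 w' * leg2 w') := by rw [h1]; noncomm_ring
    _ = leg2 v' * leg1 v' * (R * (leg1 w' * leg2 w')) := by rw [hv']; noncomm_ring
    _ = leg2 v' * (leg1 v' * leg2 w') * leg1 w' * R := by rw [hw']; noncomm_ring
    _ = leg2 v' * leg2 w' * (leg1 v' * leg1 w') * R := by rw [h2]; noncomm_ring

/-- The inverse of an FRT matrix satisfies the FRT relations in the opposite algebra. -/
lemma IsFRT.op_inverse {v t : Fin n → Fin n → B} (hv : IsFRT q θ v)
    (hvt : ∀ i j, ∑ k, v i k * t k j = if i = j then 1 else 0)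
    (htv : ∀ i j, ∑ k, t i k * v k j = if i = j then 1 else 0) :
    IsFRT q θ fun i j => MulOpposite.op (t i j) := by
  let v' : Matrix (Fin n) (Fin n) B := Matrix.of v
  let t' : Matrix (Fin n) (Fin n) B := Matrix.of t
  have hv' : IsFRT q θ v' := hv
  have h1 : v' * t' = 1 := by ext i j; rw [Matrix.mul_apply, Matrix.one_apply]; exact hvt i j
  have h2 : t' * v' = 1 := by ext i j; rw [Matrix.mul_apply, Matrix.one_apply]; exact htv i j
  change IsFRT q θ fun i j => MulOpposite.op (t' i j)
  rw [isFRT_op_iff_legs]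
  rw [isFRT_iff_legs] at hv'
  have a1 : leg1 v' * leg1 t' = 1 := by rw [← leg1_mul, h1, leg1_one]
  have a2 : leg1 t' * leg1 v' = 1 := by rw [← leg1_mul, h2, leg1_one]
  have b1 : leg2 v' * leg2 t' = 1 := by rw [← leg2_mul, h1, leg2_one]
  have b2 : leg2 t' * leg2 v' = 1 := by rw [← leg2_mul, h2, leg2_one]
  set R := (hayashiR q θ).map (algebraMap ℂ B)
  calc R * (leg2 t' * leg1 t')
      = leg1 t' * (leg2 t' * leg2 v') * leg1 v' * R * (leg2 t' * leg1 t') := by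
        rw [b2, mul_one, a2, one_mul]
    _ = leg1 t' * leg2 t' * (leg2 v' * leg1 v' * R) * (leg2 t' * leg1 t') := by noncomm_ring
    _ = leg1 t' * leg2 t' * R * (leg1 v' * (leg2 v' * leg2 t') * leg1 t') := by
        rw [← hv']; noncomm_ring
    _ = leg1 t' * leg2 t' * R := by rw [b1, mul_one, a1, mul_one]

lemma IsFRT.map {C : Type*} [Ring C] [Algebra ℂ C] {v : Fin n → Fin n → B} (hv : IsFRT q θ v)
    (f : B →ₐ[ℂ] C) : IsFRT q θ fun i j => f (v i j) := by
  intro i j r s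
  have := congrArg f (hv i j r s)
  simpa only [map_sum, map_smul, map_mul] using this

lemma map_qMinor {C : Type*} [Ring C] [Algebra ℂ C] (f : B →ₐ[ℂ] C) (v : Fin n → Fin n → B)
    {r : ℕ} (I J : Fin r → Fin n) :
    f (qMinor q θ v I J) = qMinor q θ (fun i j => f (v i j)) I J := by
  simp only [qMinor, map_sum, map_smul, map_list_prod, List.map_ofFn, Function.comp_def]

lemma map_qDet {C : Type*} [Ring C] [Algebra ℂ C] (f : B →ₐ[ℂ] C) (v : Fin n → Fin n → B) :
    f (qDet q θ v) = qDet q θ fun i j => f (v i j) :=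
  map_qMinor f v id id

end Legs

/-! ### Generators and the universal property -/

/-- A left inverse and a right inverse of a square matrix agree, in entries. Most identities for the
antipode below are deduced from this, by checking that both sides invert the same matrix. -/
lemma matrix_inverse_unique {n : ℕ} {B : Type*} [Ring B] {t v t' : Fin n → Fin n → B}
    (htv : ∀ i j, ∑ k, t i k * v k j = if i = j then 1 else 0)
    (hvt : ∀ i j, ∑ k, v i k * t' k j = if i = j then 1 else 0) (i j : Fin n) : t i j = t' i j := by
  have h1 : Matrix.of t * Matrix.of v = 1 := by
    ext i j; rw [Matrix.mul_apply, Matrix.one_apply]; exact htv i j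
  have h2 : Matrix.of v * Matrix.of t' = 1 := by
    ext i j; rw [Matrix.mul_apply, Matrix.one_apply]; exact hvt i j
  exact congrFun (congrFun (left_inv_eq_right_inv (M := Matrix (Fin n) (Fin n) B) h1 h2) i) j

section Generators

variable {n : ℕ} {q : ℝ} {θ : Fin n → Fin n → ℂ}

/-- A property of elements of `ℂ[U_{q,Θ}(n)]` holds if it holds on scalars and generators and
passes to sums and products. -/
lemma CU.induction {P : CU n q θ → Prop} (halg : ∀ c : ℂ, P (algebraMap ℂ (CU n q θ) c))
    (hV : ∀ i j, P (V q θ i j)) (hD : P (Dinv q θ)) (hmul : ∀ a b, P a → P b → P (a * b))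
    (hadd : ∀ a b, P a → P b → P (a + b)) (a : CU n q θ) : P a := by
  obtain ⟨x, rfl⟩ : ∃ x, CU.mk q θ x = a := RingQuot.mkAlgHom_surjective ℂ (Rel q θ) a
  induction x using FreeAlgebra.induction with
  | grade0 c => rw [AlgHom.commutes]; exact halg c
  | grade1 g =>
    cases g with
    | V i j => exact hV i j
    | Dinv => exact hD
  | mul x y hx hy => rw [map_mul]; exact hmul _ _ hx hy
  | add x y hx hy => rw [map_add]; exact hadd _ _ hx hy

lemma CU.mk_rel {x y : FreeAlgebra ℂ (Gen n)} (h : Rel q θ x y) : CU.mk q θ x = CU.mk q θ y :=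
  RingQuot.mkAlgHom_rel ℂ h

lemma isFRT_V : IsFRT q θ (V q θ) := by
  intro i j r s
  have := CU.mk_rel (Rel.frt (q := q) (θ := θ) i j r s)
  simp only [map_sum, map_smul, map_mul] at this
  exact this

lemma V_mul_Dinv (i k : Fin n) :
    weight θ k • (V q θ i k * Dinv q θ) = weight θ i • (Dinv q θ * V q θ i k) := by
  have := CU.mk_rel (Rel.comm (q := q) (θ := θ) i k)
  simp only [map_smul, map_mul] at this
  exact this

lemma Det_mul_Dinv : Det q θ * Dinv q θ = 1 := by
  have := CU.mk_rel (Rel.det (q := q) (θ := θ))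
  rw [map_mul, map_one, map_qDet] at this
  exact this

variable {B : Type*} [Ring B] [Algebra ℂ B]

/-- Prescribed images of the generators, as one function. -/
def genMap (v : Fin n → Fin n → B) (d : B) : Gen n → B
  | Gen.V i j => v i j
  | Gen.Dinv => d

/-- The universal property: the algebra map out of `ℂ[U_{q,Θ}(n)]` with prescribed images of the
generators that satisfy the relations. -/
def CU.lift (v : Fin n → Fin n → B) (d : B) (hv : IsFRT q θ v)
    (hcomm : ∀ i k, weight θ k • (v i k * d) = weight θ i • (d * v i k))
    (hdet : qDet q θ v * d = 1) : CU n q θ →ₐ[ℂ] B :=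
  RingQuot.liftAlgHom ℂ ⟨FreeAlgebra.lift ℂ (genMap v d), by
    have h1 : ∀ i j, FreeAlgebra.lift ℂ (genMap v d) (freeV i j) = v i j := fun i j =>
      FreeAlgebra.lift_ι_apply _ _
    have h2 : FreeAlgebra.lift ℂ (genMap v d) freeDinv = d := FreeAlgebra.lift_ι_apply _ _
    intro x y h
    cases h with
    | frt i j r s =>
      simp only [map_sum, map_smul, map_mul, h1]
      exact hv i j r s
    | comm i k =>
      simp only [map_smul, map_mul, h1, h2]
      exact hcomm i k
    | det => simp only [map_mul, map_qDet, h1, h2, map_one, hdet]⟩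

section lift

variable {v : Fin n → Fin n → B} {d : B} (hv : IsFRT q θ v)
    (hcomm : ∀ i k, weight θ k • (v i k * d) = weight θ i • (d * v i k))
    (hdet : qDet q θ v * d = 1)

@[simp] lemma CU.lift_V (i j : Fin n) : CU.lift v d hv hcomm hdet (V q θ i j) = v i j := by
  refine (RingQuot.liftAlgHom_mkAlgHom_apply ℂ _ _ _).trans ?_
  exact FreeAlgebra.lift_ι_apply _ _

@[simp] lemma CU.lift_Dinv : CU.lift v d hv hcomm hdet (Dinv q θ) = d := by
  refine (RingQuot.liftAlgHom_mkAlgHom_apply ℂ _ _ _).trans ?_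
  exact FreeAlgebra.lift_ι_apply _ _

end lift

lemma CU.algHom_ext {f g : CU n q θ →ₐ[ℂ] B} (hV : ∀ i j, f (V q θ i j) = g (V q θ i j))
    (hD : f (Dinv q θ) = g (Dinv q θ)) : f = g := by
  ext a
  induction a using CU.induction with
  | halg c => rw [AlgHom.commutes, AlgHom.commutes]
  | hV i j => exact hV i j
  | hD => exact hD
  | hmul a b ha hb => rw [map_mul, map_mul, ha, hb]
  | hadd a b ha hb => rw [map_add, map_add, ha, hb]

end Generators

/-! ### The inverse of the generator matrix -/

section Inverse

variable {n : ℕ} {q : ℝ} {θ : Fin n → Fin n → ℂ}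

lemma weight_ne_zero (hθ : IsParam θ) (k : Fin n) : weight θ k ≠ 0 :=
  Finset.prod_ne_zero_iff.2 fun _ _ => hθ.ne_zero _ _

lemma kappa_ne_zero (hθ : IsParam θ) (k : Fin n) : kappa θ k ≠ 0 :=
  Finset.prod_ne_zero_iff.2 fun _ _ => hθ.ne_zero _ _

lemma V_mul_Dinv_eq_smul (hθ : IsParam θ) (i k : Fin n) :
    V q θ i k * Dinv q θ = (weight θ i / weight θ k) • (Dinv q θ * V q θ i k) := by
  rw [div_eq_inv_mul, mul_smul, ← V_mul_Dinv, inv_smul_smul₀ (weight_ne_zero hθ k)]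

/-- Moving `𝒟⁻¹` past a monomial multiplies it by the weights of the rows over those of the
columns. -/
lemma prod_ofFn_V_mul_Dinv (hθ : IsParam θ) {r : ℕ} (I J : Fin r → Fin n) :
    (List.ofFn fun x => V q θ (I x) (J x)).prod * Dinv q θ =
      (∏ x, weight θ (I x) / weight θ (J x)) •
        (Dinv q θ * (List.ofFn fun x => V q θ (I x) (J x)).prod) := by
  induction r with
  | zero => simp
  | succ r ih =>
    rw [List.ofFn_succ, List.prod_cons, mul_assoc, ih (fun x => I x.succ) fun x => J x.succ,
      Fin.prod_univ_succ, mul_smul_comm, ← mul_assoc, V_mul_Dinv_eq_smul hθ, smul_mul_assoc,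
      smul_smul, mul_assoc, mul_comm (weight θ (I 0) / weight θ (J 0))]

/-- In the monomials of the determinant, every index occurs once as a row and once as a column. So
`𝒟⁻¹` commutes with the determinant and is its inverse on both sides. -/
lemma Dinv_mul_Det (hθ : IsParam θ) : Dinv q θ * Det q θ = 1 := by
  rw [← Det_mul_Dinv, Det, qDet, qMinor, Finset.sum_mul, Finset.mul_sum]
  refine Finset.sum_congr rfl fun σ _ => ?_
  rw [smul_mul_assoc, mul_smul_comm, prod_ofFn_V_mul_Dinv hθ, Finset.prod_div_distrib]
  simp only [id]
  rw [Equiv.prod_comp σ (weight θ), div_self, one_smul]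
  exact Finset.prod_ne_zero_iff.2 fun k _ => weight_ne_zero hθ k

lemma prod_Ioi_minorCoeff (hθ : IsParam θ) (k : Fin n) :
    ∏ l ∈ Finset.Ioi k, minorCoeff q θ k l =
      (-(q : ℂ)) ^ (n - 1 - (k : ℕ)) * (kappa θ k)⁻¹ := by
  simp only [minorCoeff]
  rw [Finset.prod_mul_distrib, Finset.prod_const, Fin.card_Ioi, kappa, ← Finset.prod_inv_distrib]
  congr 1
  exact Finset.prod_congr rfl fun l _ => eq_inv_of_mul_eq_one_left (hθ.mul_swap k l)

lemma prod_Ioi_minorCoeff_swap (k : Fin n) :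
    ∏ l ∈ Finset.Ioi k, minorCoeff q θ l k = (-(q : ℂ)) ^ (n - 1 - (k : ℕ)) * kappa θ k := by
  simp only [minorCoeff]
  rw [Finset.prod_mul_distrib, Finset.prod_const, Fin.card_Ioi, kappa]

/-- Here `κ_k / w_k` is the inverse of `∏_{l < k} θ_{l,k}`. -/
lemma prod_Iio_minorCoeff (hθ : IsParam θ) (k : Fin n) :
    ∏ l ∈ Finset.Iio k, minorCoeff q θ k l =
      (-(q : ℂ)) ^ (k : ℕ) * (kappa θ k / weight θ k) := by
  simp only [minorCoeff]
  rw [Finset.prod_mul_distrib, Finset.prod_const, Fin.card_Iio]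
  congr 1
  rw [eq_div_iff (weight_ne_zero hθ k), kappa, weight]
  have : ({k}ᶜ : Finset (Fin n)) = Finset.Iio k ∪ Finset.Ioi k := by
    ext l; simp
  rw [this, Finset.prod_union (by
    rw [Finset.disjoint_left]; intro l h1 h2
    exact lt_asymm (Finset.mem_Iio.1 h1) (Finset.mem_Ioi.1 h2)), ← mul_assoc,
    ← Finset.prod_mul_distrib, Finset.prod_congr rfl fun l _ => hθ.mul_swap k l]
  simp

/-- The value `S(V_{i,k})` of the antipode, which is the entry of the inverse of the matrix `V`. -/
def invV (q : ℝ) (θ : Fin n → Fin n → ℂ) (i k : Fin n) : CU n q θ :=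
  (kappa θ i / kappa θ k * (-(q : ℂ)) ^ ((i : ℤ) - (k : ℤ))) • (Dinv q θ * M q θ k i)

lemma sum_invV_mul_V (hq : q ≠ 0) (hθ : IsParam θ) (i j : Fin n) :
    ∑ k, invV q θ i k * V q θ k j = if i = j then 1 else 0 := by
  have hq' : -(q : ℂ) ≠ 0 := by simpa using hq
  have key := sum_qCofactor_mul hq hθ (isFRT_V (q := q) (θ := θ)) j i
  have h : ∀ k, invV q θ i k * V q θ k j =
      (kappa θ i * (-(q : ℂ)) ^ ((i : ℤ) - (n - 1))) • (Dinv q θ *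
        ((∏ l ∈ Finset.Ioi k, minorCoeff q θ k l) •
          (qCofactor q θ (V q θ) k i * V q θ k j))) := by
    intro k
    rw [invV, M, smul_mul_assoc, mul_smul_comm, smul_smul, mul_assoc, prod_Ioi_minorCoeff hθ]
    congr 1
    have : (-(q : ℂ)) ^ ((i : ℤ) - (k : ℤ)) =
        (-(q : ℂ)) ^ ((i : ℤ) - (n - 1)) * (-(q : ℂ)) ^ (n - 1 - (k : ℕ)) := by
      rw [← zpow_natCast, ← zpow_add₀ hq']
      congr 1
      have := k.2
      omega
    rw [this]
    ring
  rw [Finset.sum_congr rfl fun k _ => h k, ← Finset.smul_sum, ← Finset.mul_sum, key]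
  by_cases hij : i = j
  · subst hij
    rw [if_pos rfl, if_pos rfl, mul_smul_comm, smul_smul, prod_Ioi_minorCoeff hθ]
    change _ • (Dinv q θ * Det q θ) = 1
    rw [Dinv_mul_Det hθ]
    have : kappa θ i * (-(q : ℂ)) ^ ((i : ℤ) - (n - 1)) *
        ((-(q : ℂ)) ^ (n - 1 - (i : ℕ)) * (kappa θ i)⁻¹) = 1 := by
      have h1 : (-(q : ℂ)) ^ ((i : ℤ) - (n - 1)) * (-(q : ℂ)) ^ (n - 1 - (i : ℕ)) = 1 := by
        rw [← zpow_natCast, ← zpow_add₀ hq', ← zpow_zero (-(q : ℂ))]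
        congr 1
        have := i.2
        omega
      linear_combination (kappa θ i * (kappa θ i)⁻¹) * h1 + mul_inv_cancel₀ (kappa_ne_zero hθ i)
    rw [this, one_smul]
  · rw [if_neg hij, if_neg (Ne.symm hij), mul_zero, smul_zero]

/-- The factors `w_i / w_k` that arise when `V_{i,k}` passes `𝒟⁻¹` turn the coefficients `κ_k` into
those of the row expansion. -/
lemma sum_V_mul_invV (hq : q ≠ 0) (hθ : IsParam θ) (i j : Fin n) :
    ∑ k, V q θ i k * invV q θ k j = if i = j then 1 else 0 := by
  have hq' : -(q : ℂ) ≠ 0 := by simpa using hq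
  have key := sum_mul_qCofactor_row hq hθ (isFRT_V (q := q) (θ := θ)) i j
  have h : ∀ k, V q θ i k * invV q θ k j =
      (weight θ i / kappa θ j * (-(q : ℂ)) ^ (-(j : ℤ))) • (Dinv q θ *
        ((∏ l ∈ Finset.Iio k, minorCoeff q θ k l) •
          (V q θ i k * qCofactor q θ (V q θ) j k))) := by
    intro k
    rw [invV, M, mul_smul_comm, mul_smul_comm, ← mul_assoc, V_mul_Dinv_eq_smul hθ, smul_mul_assoc,
      smul_smul, smul_smul, mul_assoc (Dinv q θ), prod_Iio_minorCoeff hθ]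
    congr 1
    have : (-(q : ℂ)) ^ ((k : ℤ) - (j : ℤ)) =
        (-(q : ℂ)) ^ (-(j : ℤ)) * (-(q : ℂ)) ^ (k : ℕ) := by
      rw [← zpow_natCast, ← zpow_add₀ hq']
      congr 1
      omega
    rw [this]
    ring
  rw [Finset.sum_congr rfl fun k _ => h k, ← Finset.smul_sum, ← Finset.mul_sum, key]
  by_cases hij : i = j
  · subst hij
    rw [if_pos rfl, if_pos rfl, mul_smul_comm, smul_smul, prod_Iio_minorCoeff hθ]
    change _ • (Dinv q θ * Det q θ) = 1
    rw [Dinv_mul_Det hθ]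
    have : weight θ i / kappa θ i * (-(q : ℂ)) ^ (-(i : ℤ)) *
        ((-(q : ℂ)) ^ (i : ℕ) * (kappa θ i / weight θ i)) = 1 := by
      rw [zpow_neg, zpow_natCast]
      have := kappa_ne_zero hθ i
      have := weight_ne_zero hθ i
      field_simp
    rw [this, one_smul]
  · rw [if_neg hij, if_neg hij, mul_zero, smul_zero]

/-- The matrix `q ^ (2 (i - k)) V_{i,k}` multiplied from the left by the entries of the inverse,
both transposed. This is the row expansion of the determinant with the minors on the left, and it
accounts for the powers of `q` in the square of the antipode. -/
lemma sum_invV_mul_V_swap (hq : q ≠ 0) (hθ : IsParam θ) (i j : Fin n) :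
    ∑ k, invV q θ k j * ((q : ℂ) ^ (2 * ((i : ℤ) - (k : ℤ))) • V q θ i k) =
      if i = j then 1 else 0 := by
  have hq' : -(q : ℂ) ≠ 0 := by simpa using hq
  have key := sum_qCofactor_mul_row hq hθ (isFRT_V (q := q) (θ := θ)) i j
  have h : ∀ k, invV q θ k j * ((q : ℂ) ^ (2 * ((i : ℤ) - (k : ℤ))) • V q θ i k) =
      ((kappa θ j)⁻¹ * (-(q : ℂ)) ^ (2 * (i : ℤ) - j - (n - 1))) • (Dinv q θ *
        ((∏ l ∈ Finset.Ioi k, minorCoeff q θ l k) •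
          (qCofactor q θ (V q θ) j k * V q θ i k))) := by
    intro k
    rw [invV, M, smul_mul_assoc, mul_smul_comm, mul_smul_comm, smul_smul, smul_smul,
      mul_assoc (Dinv q θ), prod_Ioi_minorCoeff_swap]
    congr 1
    have h2 : (q : ℂ) ^ (2 * ((i : ℤ) - (k : ℤ))) = (-(q : ℂ)) ^ (2 * ((i : ℤ) - (k : ℤ))) :=
      ((even_two_mul _).neg_zpow _).symm
    have : (-(q : ℂ)) ^ ((k : ℤ) - (j : ℤ)) * (-(q : ℂ)) ^ (2 * ((i : ℤ) - (k : ℤ))) =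
        (-(q : ℂ)) ^ (2 * (i : ℤ) - j - (n - 1)) * (-(q : ℂ)) ^ (n - 1 - (k : ℕ)) := by
      rw [← zpow_natCast, ← zpow_add₀ hq', ← zpow_add₀ hq']
      congr 1
      have := k.2
      omega
    rw [h2]
    linear_combination (kappa θ k / kappa θ j) * this
  rw [Finset.sum_congr rfl fun k _ => h k, ← Finset.smul_sum, ← Finset.mul_sum, key]
  by_cases hij : i = j
  · subst hij
    rw [if_pos rfl, if_pos rfl, mul_smul_comm, smul_smul, prod_Ioi_minorCoeff_swap]
    change _ • (Dinv q θ * Det q θ) = 1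
    rw [Dinv_mul_Det hθ]
    have : (kappa θ i)⁻¹ * (-(q : ℂ)) ^ (2 * (i : ℤ) - i - (n - 1)) *
        ((-(q : ℂ)) ^ (n - 1 - (i : ℕ)) * kappa θ i) = 1 := by
      have h1 : (-(q : ℂ)) ^ (2 * (i : ℤ) - i - (n - 1)) * (-(q : ℂ)) ^ (n - 1 - (i : ℕ)) = 1 := by
        rw [← zpow_natCast, ← zpow_add₀ hq', ← zpow_zero (-(q : ℂ))]
        congr 1
        have := i.2
        omega
      linear_combination (kappa θ i * (kappa θ i)⁻¹) * h1 + mul_inv_cancel₀ (kappa_ne_zero hθ i)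
    rw [this, one_smul]
  · rw [if_neg hij, if_neg hij, mul_zero, smul_zero]

/-- The matrix with entries `(w_i / w_k) 𝒟⁻¹ S(V_{i,k}) Det` is also an inverse of `V`. -/
lemma Det_mul_invV (hq : q ≠ 0) (hθ : IsParam θ) (i k : Fin n) :
    weight θ k • (Det q θ * invV q θ i k) = weight θ i • (invV q θ i k * Det q θ) := by
  have h : invV q θ i k =
      (weight θ i / weight θ k) • (Dinv q θ * invV q θ i k * Det q θ) := by
    refine matrix_inverse_unique (v := V q θ)
      (t' := fun i k => (weight θ i / weight θ k) • (Dinv q θ * invV q θ i k * Det q θ))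
      (sum_invV_mul_V hq hθ) (fun i j => ?_) i k
    have h1 : ∀ k, V q θ i k * ((weight θ k / weight θ j) • (Dinv q θ * invV q θ k j * Det q θ)) =
        (weight θ i / weight θ j) • (Dinv q θ * (V q θ i k * invV q θ k j) * Det q θ) := by
      intro k
      rw [mul_smul_comm, ← mul_assoc, ← mul_assoc, V_mul_Dinv_eq_smul hθ, smul_mul_assoc,
        smul_mul_assoc, smul_smul, mul_assoc (Dinv q θ)]
      congr 1
      have := weight_ne_zero hθ k
      field_simp
    rw [Finset.sum_congr rfl fun k _ => h1 k, ← Finset.smul_sum, ← Finset.sum_mul, ← Finset.mul_sum,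
      sum_V_mul_invV hq hθ]
    by_cases hij : i = j
    · subst hij
      rw [if_pos rfl, mul_one, Dinv_mul_Det hθ, div_self (weight_ne_zero hθ i), one_smul]
    · rw [if_neg hij, mul_zero, zero_mul, smul_zero]
  conv_lhs => rw [h]
  rw [mul_smul_comm, smul_smul, mul_div_cancel₀ _ (weight_ne_zero hθ k), ← mul_assoc, ← mul_assoc,
    Det_mul_Dinv, one_mul]

end Inverse

/-! ### The antipode axiom on products -/

section AntipodeAxiom

variable {A : Type*} [Ring A] [Algebra ℂ A] (S : A →ₐ[ℂ] Aᵐᵒᵖ)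

/-- An algebra map into the opposite algebra, as a linear endomorphism. -/
def antiLinear : A →ₗ[ℂ] A := (MulOpposite.opLinearEquiv ℂ).symm.toLinearMap ∘ₗ S.toLinearMap

lemma antiLinear_apply (a : A) : antiLinear S a = (S a).unop := rfl

lemma antiLinear_mul (a b : A) : antiLinear S (a * b) = antiLinear S b * antiLinear S a := by
  simp [antiLinear_apply]

/-- If `m (S ⊗ id)` sends `X` to the scalar `c`, then it sends `X * Y` to `c` times the image of
`Y`. Applied to `X = Δ a` and `Y = Δ b`, this shows that the antipode axiom passes from `a` and `b`
to `a b`. -/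
lemma mul_rTensor_antiLinear_mul {X : A ⊗[ℂ] A} {c : ℂ}
    (hX : LinearMap.mul' ℂ A ((antiLinear S).rTensor A X) = algebraMap ℂ A c) (Y : A ⊗[ℂ] A) :
    LinearMap.mul' ℂ A ((antiLinear S).rTensor A (X * Y)) =
      c • LinearMap.mul' ℂ A ((antiLinear S).rTensor A Y) := by
  induction Y with
  | zero => simp
  | add Y Z hY hZ => simp only [mul_add, map_add, hY, hZ, smul_add]
  | tmul a b =>
    have h : ∀ X : A ⊗[ℂ] A, LinearMap.mul' ℂ A ((antiLinear S).rTensor A (X * a ⊗ₜ b)) =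
        antiLinear S a * LinearMap.mul' ℂ A ((antiLinear S).rTensor A X) * b := by
      intro X
      induction X with
      | zero => simp
      | add X Y hX hY => simp only [add_mul, mul_add, map_add, hX, hY]
      | tmul x y => simp [antiLinear_mul, mul_assoc]
    rw [h, hX, ← Algebra.commutes, ← Algebra.smul_def]
    simp

/-- The version of `mul_rTensor_antiLinear_mul` for the other antipode axiom. -/
lemma mul_lTensor_antiLinear_mul {Y : A ⊗[ℂ] A} {c : ℂ}
    (hY : LinearMap.mul' ℂ A ((antiLinear S).lTensor A Y) = algebraMap ℂ A c) (X : A ⊗[ℂ] A) :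
    LinearMap.mul' ℂ A ((antiLinear S).lTensor A (X * Y)) =
      c • LinearMap.mul' ℂ A ((antiLinear S).lTensor A X) := by
  induction X with
  | zero => simp
  | add Y Z hY hZ => simp only [add_mul, map_add, hY, hZ, smul_add]
  | tmul a b =>
    have h : ∀ Y : A ⊗[ℂ] A, LinearMap.mul' ℂ A ((antiLinear S).lTensor A (a ⊗ₜ b * Y)) =
        a * LinearMap.mul' ℂ A ((antiLinear S).lTensor A Y) * antiLinear S b := by
      intro X
      induction X with
      | zero => simp
      | add X Y hX hY => simp only [mul_add, add_mul, map_add, hX, hY]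
      | tmul x y => simp [antiLinear_mul, mul_assoc]
    rw [h, hY, ← Algebra.commutes, mul_assoc, ← Algebra.smul_def]
    simp

end AntipodeAxiom

/-! ### The Hopf algebra structure -/

section Hopf

variable {n : ℕ} {q : ℝ} {θ : Fin n → Fin n → ℂ}

lemma commute_tmul_one_one_tmul {B C : Type*} [Ring B] [Algebra ℂ B] [Ring C] [Algebra ℂ C]
    (b : B) (c : C) : Commute (b ⊗ₜ[ℂ] (1 : C)) ((1 : B) ⊗ₜ[ℂ] c) := by
  rw [commute_iff_eq, Algebra.TensorProduct.tmul_mul_tmul, Algebra.TensorProduct.tmul_mul_tmul,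
    mul_one, one_mul, mul_one, one_mul]

section tensor

variable {B C : Type*} [Ring B] [Algebra ℂ B] [Ring C] [Algebra ℂ C]
    {v : Fin n → Fin n → B} {w : Fin n → Fin n → C}

lemma sum_tmul_eq_sum_mul : (fun i j => ∑ k, v i k ⊗ₜ[ℂ] w k j) =
    fun i j => ∑ k, v i k ⊗ₜ[ℂ] (1 : C) * (1 : B) ⊗ₜ[ℂ] w k j := by
  simp only [Algebra.TensorProduct.tmul_mul_tmul, mul_one, one_mul]

lemma IsFRT.tmul (hv : IsFRT q θ v) (hw : IsFRT q θ w) :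
    IsFRT q θ fun i j => ∑ k, v i k ⊗ₜ[ℂ] w k j := by
  rw [sum_tmul_eq_sum_mul]
  exact (hv.map (Algebra.TensorProduct.includeLeft : B →ₐ[ℂ] B ⊗[ℂ] C)).mul
    (hw.map (Algebra.TensorProduct.includeRight : C →ₐ[ℂ] B ⊗[ℂ] C))
    fun _ _ _ _ => commute_tmul_one_one_tmul _ _

lemma qDet_tmul (hq : q ≠ 0) (hθ : IsParam θ) (hv : IsFRT q θ v) :
    qDet q θ (fun i j => ∑ k, v i k ⊗ₜ[ℂ] w k j) = qDet q θ v ⊗ₜ qDet q θ w := by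
  have h := qDet_mul hq hθ (hv.map (Algebra.TensorProduct.includeLeft : B →ₐ[ℂ] B ⊗[ℂ] C))
    (w := fun i j => (Algebra.TensorProduct.includeRight : C →ₐ[ℂ] B ⊗[ℂ] C) (w i j))
    fun _ _ _ _ => commute_tmul_one_one_tmul _ _
  rw [← map_qDet, ← map_qDet] at h
  rw [sum_tmul_eq_sum_mul]
  refine h.trans ?_
  simp only [Algebra.TensorProduct.includeLeft_apply, Algebra.TensorProduct.includeRight_apply,
    Algebra.TensorProduct.tmul_mul_tmul, mul_one, one_mul]

end tensor

/-- The elements `Δ(V_{i,k})` and `Δ(𝒟⁻¹)` satisfy the commutation relation. -/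
lemma comul_comm (i k : Fin n) :
    weight θ k • ((∑ j, V q θ i j ⊗ₜ[ℂ] V q θ j k) * Dinv q θ ⊗ₜ[ℂ] Dinv q θ) =
      weight θ i • (Dinv q θ ⊗ₜ[ℂ] Dinv q θ * ∑ j, V q θ i j ⊗ₜ[ℂ] V q θ j k) := by
  simp only [Finset.sum_mul, Finset.mul_sum, Finset.smul_sum, Algebra.TensorProduct.tmul_mul_tmul]
  refine Finset.sum_congr rfl fun j _ => ?_
  rw [← TensorProduct.tmul_smul, V_mul_Dinv, TensorProduct.tmul_smul, TensorProduct.smul_tmul',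
    V_mul_Dinv, ← TensorProduct.smul_tmul']

/-- The comultiplication, as an algebra map. -/
def comulHom (hq : q ≠ 0) (hθ : IsParam θ) : CU n q θ →ₐ[ℂ] CU n q θ ⊗[ℂ] CU n q θ :=
  CU.lift (fun i j => ∑ k, V q θ i k ⊗ₜ V q θ k j) (Dinv q θ ⊗ₜ Dinv q θ)
    (isFRT_V.tmul isFRT_V) comul_comm
    (by
      rw [qDet_tmul hq hθ isFRT_V, Algebra.TensorProduct.tmul_mul_tmul]
      change (Det q θ * _) ⊗ₜ[ℂ] (Det q θ * _) = _
      rw [Det_mul_Dinv, Algebra.TensorProduct.one_def])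

@[simp] lemma comulHom_V (hq : q ≠ 0) (hθ : IsParam θ) (i j : Fin n) :
    comulHom hq hθ (V q θ i j) = ∑ k, V q θ i k ⊗ₜ V q θ k j :=
  CU.lift_V ..

@[simp] lemma comulHom_Dinv (hq : q ≠ 0) (hθ : IsParam θ) :
    comulHom hq hθ (Dinv q θ) = Dinv q θ ⊗ₜ Dinv q θ :=
  CU.lift_Dinv ..

/-- The counit, as an algebra map. -/
def counitHom (q : ℝ) (θ : Fin n → Fin n → ℂ) : CU n q θ →ₐ[ℂ] ℂ :=
  CU.lift (fun i j => if i = j then 1 else 0) 1 isFRT_one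
    (fun i k => by by_cases h : i = k <;> simp [h])
    (by rw [qDet_one, one_mul])

@[simp] lemma counitHom_V (i j : Fin n) : counitHom q θ (V q θ i j) = if i = j then 1 else 0 :=
  CU.lift_V ..

@[simp] lemma counitHom_Dinv : counitHom q θ (Dinv q θ) = 1 :=
  CU.lift_Dinv ..

/-- The antipode, as an algebra map into the opposite algebra. -/
def antipodeHom (hq : q ≠ 0) (hθ : IsParam θ) : CU n q θ →ₐ[ℂ] (CU n q θ)ᵐᵒᵖ :=
  CU.lift (fun i j => MulOpposite.op (invV q θ i j)) (MulOpposite.op (Det q θ))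
    (isFRT_V.op_inverse (sum_V_mul_invV hq hθ) (sum_invV_mul_V hq hθ))
    (fun i k => MulOpposite.unop_injective (Det_mul_invV hq hθ i k))
    (MulOpposite.unop_injective (qDet_mul_unop_qDet_op hq hθ isFRT_V (sum_V_mul_invV hq hθ)))

/-- The antipode, as a linear map. -/
def antipodeMap (hq : q ≠ 0) (hθ : IsParam θ) : CU n q θ →ₗ[ℂ] CU n q θ :=
  antiLinear (antipodeHom hq hθ)

@[simp] lemma antipodeMap_V (hq : q ≠ 0) (hθ : IsParam θ) (i j : Fin n) :
    antipodeMap hq hθ (V q θ i j) = invV q θ i j :=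
  congrArg MulOpposite.unop (CU.lift_V ..)

@[simp] lemma antipodeMap_Dinv (hq : q ≠ 0) (hθ : IsParam θ) :
    antipodeMap hq hθ (Dinv q θ) = Det q θ :=
  congrArg MulOpposite.unop (CU.lift_Dinv ..)

@[simp] lemma antipodeMap_mul (hq : q ≠ 0) (hθ : IsParam θ) (a b : CU n q θ) :
    antipodeMap hq hθ (a * b) = antipodeMap hq hθ b * antipodeMap hq hθ a :=
  antiLinear_mul _ a b

@[simp] lemma antipodeMap_algebraMap (hq : q ≠ 0) (hθ : IsParam θ) (c : ℂ) :
    antipodeMap hq hθ (algebraMap ℂ (CU n q θ) c) = algebraMap ℂ (CU n q θ) c := by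
  rw [antipodeMap, antiLinear_apply, AlgHom.commutes]
  rfl

@[simp] lemma antipodeMap_one (hq : q ≠ 0) (hθ : IsParam θ) :
    antipodeMap hq hθ (1 : CU n q θ) = 1 := by
  rw [← map_one (algebraMap ℂ (CU n q θ)), antipodeMap_algebraMap]

lemma antipodeMap_Det (hq : q ≠ 0) (hθ : IsParam θ) :
    antipodeMap hq hθ (Det q θ) = Dinv q θ := by
  have h := congrArg (antipodeMap hq hθ) (Dinv_mul_Det (q := q) hθ)
  rw [antipodeMap_mul, antipodeMap_Dinv, antipodeMap_one] at h
  exact left_inv_eq_right_inv h Det_mul_Dinv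

lemma mul_antipode_rTensor (hq : q ≠ 0) (hθ : IsParam θ) (a : CU n q θ) :
    LinearMap.mul' ℂ (CU n q θ) ((antipodeMap hq hθ).rTensor _ (comulHom hq hθ a)) =
      algebraMap ℂ _ (counitHom q θ a) := by
  induction a using CU.induction with
  | halg c =>
    simp only [AlgHom.commutes, Algebra.TensorProduct.algebraMap_apply, LinearMap.rTensor_tmul,
      antipodeMap_algebraMap, LinearMap.mul'_apply, mul_one]
    rfl
  | hV i j =>
    simp only [comulHom_V, map_sum, LinearMap.rTensor_tmul, antipodeMap_V, LinearMap.mul'_apply,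
      sum_invV_mul_V hq hθ, counitHom_V]
    split_ifs <;> simp
  | hD => simp [Det_mul_Dinv]
  | hmul a b ha hb =>
    rw [map_mul, antipodeMap, mul_rTensor_antiLinear_mul _ ha, ← antipodeMap, hb, map_mul, map_mul,
      Algebra.smul_def]
  | hadd a b ha hb => simp only [map_add, ha, hb]

lemma mul_antipode_lTensor (hq : q ≠ 0) (hθ : IsParam θ) (a : CU n q θ) :
    LinearMap.mul' ℂ (CU n q θ) ((antipodeMap hq hθ).lTensor _ (comulHom hq hθ a)) =
      algebraMap ℂ _ (counitHom q θ a) := by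
  induction a using CU.induction with
  | halg c =>
    simp only [AlgHom.commutes, Algebra.TensorProduct.algebraMap_apply, LinearMap.lTensor_tmul,
      antipodeMap_one, LinearMap.mul'_apply, mul_one]
    rfl
  | hV i j =>
    simp only [comulHom_V, map_sum, LinearMap.lTensor_tmul, antipodeMap_V, LinearMap.mul'_apply,
      sum_V_mul_invV hq hθ, counitHom_V]
    split_ifs <;> simp
  | hD => simp [Dinv_mul_Det hθ]
  | hmul a b ha hb =>
    rw [map_mul, antipodeMap, mul_lTensor_antiLinear_mul _ hb, ← antipodeMap, ha, map_mul, map_mul,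
      Algebra.smul_def, ← Algebra.commutes]
  | hadd a b ha hb => simp only [map_add, ha, hb]

/-- The bialgebra structure on `ℂ[U_{q,Θ}(n)]`. -/
abbrev CU.bialgebra (hq : q ≠ 0) (hθ : IsParam θ) : Bialgebra ℂ (CU n q θ) :=
  Bialgebra.ofAlgHom (comulHom hq hθ) (counitHom q θ)
    (CU.algHom_ext
      (fun i j => by
        simp only [AlgHom.coe_comp, Function.comp_apply, comulHom_V, map_sum,
          Algebra.TensorProduct.map_tmul, AlgHom.coe_id, id, TensorProduct.sum_tmul,
          TensorProduct.tmul_sum]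
        rw [Finset.sum_comm]
        rfl)
      (by simp))
    (CU.algHom_ext
      (fun i j => by simp [TensorProduct.ite_tmul])
      (by simp))
    (CU.algHom_ext
      (fun i j => by simp [TensorProduct.tmul_ite])
      (by simp))

/-- The Hopf algebra structure on `ℂ[U_{q,Θ}(n)]`. -/
abbrev CU.hopfAlgebra (hq : q ≠ 0) (hθ : IsParam θ) : HopfAlgebra ℂ (CU n q θ) :=
  { CU.bialgebra hq hθ with
    antipode := antipodeMap hq hθ
    mul_antipode_rTensor_comul := LinearMap.ext (mul_antipode_rTensor hq hθ)
    mul_antipode_lTensor_comul := LinearMap.ext (mul_antipode_lTensor hq hθ) }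

lemma CU.isHopfStructure_hopfAlgebra (hq : q ≠ 0) (hθ : IsParam θ) :
    IsHopfStructure q θ (CU.hopfAlgebra hq hθ) where
  algebra_eq := rfl
  matrix_coalgebra :=
    letI := CU.hopfAlgebra hq hθ
    { comul_v := comulHom_V hq hθ
      counit_v := counitHom_V
      comul_d := comulHom_Dinv hq hθ
      counit_d := counitHom_Dinv }

/-- The antipode is the convolution inverse of the identity, so the bialgebra determines it. -/
lemma antipode_unique {A : Type*} [Ring A] [Bialgebra ℂ A] {S S' : A →ₗ[ℂ] A}
    (h : LinearMap.mul' ℂ A ∘ₗ S.rTensor A ∘ₗ Coalgebra.comul =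
      Algebra.linearMap ℂ A ∘ₗ Coalgebra.counit)
    (h' : LinearMap.mul' ℂ A ∘ₗ S'.lTensor A ∘ₗ Coalgebra.comul =
      Algebra.linearMap ℂ A ∘ₗ Coalgebra.counit) : S = S' := by
  have e1 : WithConv.toConv S * WithConv.toConv LinearMap.id = 1 := congrArg WithConv.toConv h
  have e2 : WithConv.toConv LinearMap.id * WithConv.toConv S' = 1 := congrArg WithConv.toConv h'
  exact congrArg WithConv.ofConv (left_inv_eq_right_inv e1 e2)

/-- Both comultiplications are algebra maps, as are both counits, and they agree on generators; the
antipode is determined by them. -/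
lemma IsHopfStructure.unique {H H' : HopfAlgebra ℂ (CU n q θ)} (h : IsHopfStructure q θ H)
    (h' : IsHopfStructure q θ H') : H = H' := by
  -- Taking the structures apart lets the two algebra structures, equal only propositionally, be
  -- identified before the algebra maps are compared.
  obtain @⟨@⟨bi, S⟩, a1, a2⟩ := H
  obtain @⟨@⟨bi', S'⟩, a1', a2'⟩ := H'
  obtain ⟨hA, cv, ev, cd, ed⟩ := h
  obtain ⟨hA', cv', ev', cd', ed'⟩ := h'
  have hbi : bi = bi' := by
    obtain @⟨alg, co, b1, b2, b3, b4⟩ := bi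
    obtain @⟨alg', co', b1', b2', b3', b4'⟩ := bi'
    change alg = _ at hA
    change alg' = _ at hA'
    subst hA hA'
    let f : CU n q θ →ₐ[ℂ] CU n q θ ⊗[ℂ] CU n q θ :=
      @Bialgebra.comulAlgHom ℂ (CU n q θ) _ _ (@Bialgebra.mk _ _ _ _ _ co b1 b2 b3 b4)
    let f' : CU n q θ →ₐ[ℂ] CU n q θ ⊗[ℂ] CU n q θ :=
      @Bialgebra.comulAlgHom ℂ (CU n q θ) _ _ (@Bialgebra.mk _ _ _ _ _ co' b1' b2' b3' b4')
    let g : CU n q θ →ₐ[ℂ] ℂ :=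
      @Bialgebra.counitAlgHom ℂ (CU n q θ) _ _ (@Bialgebra.mk _ _ _ _ _ co b1 b2 b3 b4)
    let g' : CU n q θ →ₐ[ℂ] ℂ :=
      @Bialgebra.counitAlgHom ℂ (CU n q θ) _ _ (@Bialgebra.mk _ _ _ _ _ co' b1' b2' b3' b4')
    have hf : f = f' := CU.algHom_ext (fun i j => (cv i j).trans (cv' i j).symm) (cd.trans cd'.symm)
    have hg : g = g' := CU.algHom_ext (fun i j => (ev i j).trans (ev' i j).symm) (ed.trans ed'.symm)
    have hc : co.comul = co'.comul := congrArg AlgHom.toLinearMap hf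
    have he : co.counit = co'.counit := congrArg AlgHom.toLinearMap hg
    clear_value f f' g g'
    obtain @⟨@⟨c, e⟩, _, _, _⟩ := co
    obtain @⟨@⟨c', e'⟩, _, _, _⟩ := co'
    change c = c' at hc
    change e = e' at he
    subst hc he
    rfl
  subst hbi
  obtain rfl : S = S' := antipode_unique a1 a2'
  rfl

end Hopf

/-! ### The conjugate-linear transpose -/

section ConjAlg

/-- The complex conjugate of an algebra `B`: the same ring, with `c` acting as `conj c` did.
Conjugate-linear ring homomorphisms into `B` are algebra maps into `ConjAlg B`, so that the
universal property of `ℂ[U_{q,Θ}(n)]` applies to them. -/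
def ConjAlg (B : Type*) : Type _ := B

variable {B : Type*} [Ring B] [Algebra ℂ B]

instance : Ring (ConjAlg B) := inferInstanceAs (Ring B)

/-- The identity map from `B` to its complex conjugate. -/
def toConj (B : Type*) [Ring B] : B ≃+* ConjAlg B := RingEquiv.refl B

instance : Algebra ℂ (ConjAlg B) :=
  ((toConj B).toRingHom.comp ((algebraMap ℂ B).comp (starRingEnd ℂ))).toAlgebra'
    fun c x => Algebra.commutes (A := B) (conj c) x

lemma toConj_smul (c : ℂ) (b : B) : toConj B (c • b) = conj c • toConj B b := by
  rw [Algebra.smul_def, Algebra.smul_def, map_mul]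
  congr 1
  change algebraMap ℂ B c = algebraMap ℂ B (conj (conj c))
  rw [Complex.conj_conj]

lemma smul_toConj (c : ℂ) (b : B) : c • toConj B b = toConj B (conj c • b) := by
  rw [toConj_smul, Complex.conj_conj]

variable {n : ℕ} {q : ℝ} {θ : Fin n → Fin n → ℂ}

lemma IsParam.conj_hayashiR (hθ : IsParam θ) (x y : Fin n × Fin n) :
    conj (hayashiR q θ x y) = hayashiR q (fun i j => θ j i) x y := by
  simp only [hayashiR, Matrix.of_apply]
  split_ifs <;> simp [hθ.conj_eq]

lemma IsFRT.toConj (hθ : IsParam θ) {v : Fin n → Fin n → B} (hv : IsFRT q (fun i j => θ j i) v) :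
    IsFRT q θ fun i j => toConj B (v i j) := by
  intro i j r s
  simp only [← map_mul, smul_toConj, ← map_sum, hθ.conj_hayashiR]
  exact congrArg _ (hv i j r s)

lemma qDet_toConj (hθ : IsParam θ) (v : Fin n → Fin n → B) :
    qDet q θ (fun i j => toConj B (v i j)) = toConj B (qDet q (fun i j => θ j i) v) := by
  simp only [qDet, qMinor, map_sum, toConj_smul, map_list_prod, List.map_ofFn, Function.comp_def,
    map_prod, map_mul, map_neg, Complex.conj_ofReal, hθ.conj_eq]

lemma IsParam.conj_weight (hθ : IsParam θ) (k : Fin n) :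
    weight θ k * conj (weight θ k) = 1 := by
  simp only [weight, map_prod, hθ.conj_eq]
  rw [← Finset.prod_mul_distrib, Finset.prod_congr rfl fun l _ => hθ.mul_swap l k,
    Finset.prod_const_one]

/-- The conjugate-linear map `V_{i,j} ↦ V_{j,i}`, `𝒟⁻¹ ↦ 𝒟⁻¹`, as an algebra map into the conjugate
algebra. It respects `Det_q 𝒟⁻¹ = 1` because the determinant equals its row expansion. -/
def transposeHom (hq : q ≠ 0) (hθ : IsParam θ) : CU n q θ →ₐ[ℂ] ConjAlg (CU n q θ) :=
  CU.lift (fun i j => toConj _ (V q θ j i)) (toConj _ (Dinv q θ))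
    (IsFRT.toConj hθ isFRT_V.transpose)
    (fun i k => by
      rw [← map_mul, ← map_mul, smul_toConj, smul_toConj, V_mul_Dinv_eq_smul hθ, smul_smul]
      congr 2
      rw [← mul_div_assoc, div_eq_iff (weight_ne_zero hθ i), mul_comm, hθ.conj_weight, mul_comm,
        hθ.conj_weight])
    (by
      rw [qDet_toConj hθ, qDet_transpose hq hθ isFRT_V, ← map_mul]
      exact congrArg _ Det_mul_Dinv)

/-- The conjugate-linear map `V_{i,j} ↦ V_{j,i}`, `𝒟⁻¹ ↦ 𝒟⁻¹`, as a ring homomorphism. -/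
def transposeMap (hq : q ≠ 0) (hθ : IsParam θ) : CU n q θ →+* CU n q θ :=
  (toConj (CU n q θ)).symm.toRingHom.comp (transposeHom hq hθ : CU n q θ →+* ConjAlg (CU n q θ))

lemma isTranspose_transposeMap (hq : q ≠ 0) (hθ : IsParam θ) :
    IsTranspose q θ (transposeMap hq hθ) where
  map_smul c a := by
    change (toConj (CU n q θ)).symm (transposeHom hq hθ (c • a)) =
      conj c • (toConj (CU n q θ)).symm (transposeHom hq hθ a)
    rw [RingEquiv.symm_apply_eq, toConj_smul, Complex.conj_conj, RingEquiv.apply_symm_apply,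
      map_smul]
  map_V i j := (toConj (CU n q θ)).symm_apply_eq.2 (CU.lift_V ..)
  map_Dinv := (toConj (CU n q θ)).symm_apply_eq.2 (CU.lift_Dinv ..)

lemma IsTranspose.map_algebraMap {ω : CU n q θ →+* CU n q θ} (h : IsTranspose q θ ω) (c : ℂ) :
    ω (algebraMap ℂ (CU n q θ) c) = algebraMap ℂ (CU n q θ) (conj c) := by
  rw [Algebra.algebraMap_eq_smul_one, h.map_smul, map_one, ← Algebra.algebraMap_eq_smul_one]

lemma IsTranspose.unique {ω ω' : CU n q θ →+* CU n q θ} (h : IsTranspose q θ ω)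
    (h' : IsTranspose q θ ω') : ω = ω' := by
  ext a
  induction a using CU.induction with
  | halg c => rw [h.map_algebraMap, h'.map_algebraMap]
  | hV i j => rw [h.map_V, h'.map_V]
  | hD => rw [h.map_Dinv, h'.map_Dinv]
  | hmul a b ha hb => rw [map_mul, map_mul, ha, hb]
  | hadd a b ha hb => rw [map_add, map_add, ha, hb]

lemma IsTranspose.map_Det (hθ : IsParam θ) {ω : CU n q θ →+* CU n q θ}
    (h : IsTranspose q θ ω) : ω (Det q θ) = Det q θ := by
  have h1 := congrArg ω (Dinv_mul_Det (q := q) hθ)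
  rw [map_mul, h.map_Dinv, map_one] at h1
  have h2 := congrArg (fun x => Det q θ * x) h1
  simpa only [← mul_assoc, Det_mul_Dinv, one_mul, mul_one] using h2

end ConjAlg

/-! ### The square of the antipode and the star structure -/

section Square

variable {n : ℕ} {q : ℝ} {θ : Fin n → Fin n → ℂ}

lemma antipodeMap_ite_one (hq : q ≠ 0) (hθ : IsParam θ) (p : Prop) [Decidable p] :
    antipodeMap hq hθ (if p then (1 : CU n q θ) else 0) = if p then 1 else 0 := by
  split_ifs <;> simp

/-- Both sides, transposed, are inverse to the transpose of the matrix `S(V)`. -/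
lemma antipodeMap_invV (hq : q ≠ 0) (hθ : IsParam θ) (i j : Fin n) :
    antipodeMap hq hθ (invV q θ i j) = (q : ℂ) ^ (2 * ((i : ℤ) - (j : ℤ))) • V q θ i j := by
  have h : ∀ j i, ∑ k, antipodeMap hq hθ (invV q θ k j) * invV q θ i k =
      if j = i then 1 else 0 := by
    intro j i
    have := congrArg (antipodeMap hq hθ) (sum_V_mul_invV hq hθ i j)
    rw [map_sum, antipodeMap_ite_one] at this
    simpa only [antipodeMap_mul, antipodeMap_V, eq_comm (a := i)] using this
  have h' : ∀ j i : Fin n, ∑ k, invV q θ k j * ((q : ℂ) ^ (2 * ((i : ℤ) - (k : ℤ))) • V q θ i k) =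
      if j = i then 1 else 0 := by
    intro j i
    rw [sum_invV_mul_V_swap hq hθ]
    simp only [eq_comm]
  exact matrix_inverse_unique (t := fun j i => antipodeMap hq hθ (invV q θ i j))
    (v := fun j i => invV q θ i j)
    (t' := fun j i => (q : ℂ) ^ (2 * ((i : ℤ) - (j : ℤ))) • V q θ i j) h h' j i

variable {ω : CU n q θ →+* CU n q θ}

/-- Applying `S ∘ ω` to `S(V) V = 1` shows that the transpose of the left-hand side is a right
inverse of the matrix `S(V)`. -/
lemma antipodeMap_map_invV (hq : q ≠ 0) (hθ : IsParam θ) (hω : IsTranspose q θ ω) (i j : Fin n) :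
    antipodeMap hq hθ (ω (invV q θ i j)) = V q θ j i := by
  refine (matrix_inverse_unique (t := V q θ) (v := invV q θ)
    (t' := fun j i => antipodeMap hq hθ (ω (invV q θ i j)))
    (sum_V_mul_invV hq hθ) (fun a b => ?_) j i).symm
  have h := congrArg (fun x => antipodeMap hq hθ (ω x)) (sum_invV_mul_V hq hθ b a)
  simp only [map_sum, map_mul, hω.map_V, antipodeMap_mul, antipodeMap_V, eq_comm (a := b)] at h
  rw [h]
  split_ifs <;> simp

/-- The operation `* = S ∘ ω`. -/
def starMap (hq : q ≠ 0) (hθ : IsParam θ) (ω : CU n q θ →+* CU n q θ) (a : CU n q θ) : CU n q θ :=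
  antipodeMap hq hθ (ω a)

lemma starMap_starMap (hq : q ≠ 0) (hθ : IsParam θ) (hω : IsTranspose q θ ω) (a : CU n q θ) :
    starMap hq hθ ω (starMap hq hθ ω a) = a := by
  unfold starMap
  induction a using CU.induction with
  | halg c => simp only [hω.map_algebraMap, antipodeMap_algebraMap, Complex.conj_conj]
  | hV i j => rw [hω.map_V, antipodeMap_V, antipodeMap_map_invV hq hθ hω]
  | hD => rw [hω.map_Dinv, antipodeMap_Dinv, hω.map_Det hθ, antipodeMap_Det]
  | hmul a b ha hb => simp only [map_mul, antipodeMap_mul, ha, hb]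
  | hadd a b ha hb => simp only [map_add, ha, hb]

lemma antipodeMap_starMap_antipodeMap_starMap (hq : q ≠ 0) (hθ : IsParam θ)
    (hω : IsTranspose q θ ω) (a : CU n q θ) :
    antipodeMap hq hθ (starMap hq hθ ω (antipodeMap hq hθ (starMap hq hθ ω a))) = a := by
  unfold starMap
  induction a using CU.induction with
  | halg c => simp only [hω.map_algebraMap, antipodeMap_algebraMap, Complex.conj_conj]
  | hV i j =>
    have hq' : (q : ℂ) ≠ 0 := by exact_mod_cast hq
    rw [hω.map_V, antipodeMap_V, antipodeMap_invV, hω.map_smul, map_zpow₀, Complex.conj_ofReal,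
      map_smul, map_smul, hω.map_V, antipodeMap_V, antipodeMap_invV, smul_smul, ← zpow_add₀ hq',
      ← mul_add, sub_add_sub_cancel, sub_self, mul_zero, zpow_zero, one_smul]
  | hD =>
    rw [hω.map_Dinv, antipodeMap_Dinv, antipodeMap_Det, hω.map_Dinv, antipodeMap_Dinv,
      antipodeMap_Det]
  | hmul a b ha hb => simp only [map_mul, antipodeMap_mul, ha, hb]
  | hadd a b ha hb => simp only [map_add, ha, hb]

/-- The right-hand side is inverse to the matrix `Δ(V)`. -/
lemma comulHom_invV (hq : q ≠ 0) (hθ : IsParam θ) (i j : Fin n) :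
    comulHom hq hθ (invV q θ i j) = ∑ k, invV q θ k j ⊗ₜ invV q θ i k := by
  refine matrix_inverse_unique (t := fun i j => comulHom hq hθ (invV q θ i j))
    (v := fun i j => comulHom hq hθ (V q θ i j))
    (t' := fun i j => ∑ k, invV q θ k j ⊗ₜ invV q θ i k) (fun i j => ?_) (fun i j => ?_) i j
  · simp only [← map_mul, ← map_sum, sum_invV_mul_V hq hθ]
    split_ifs <;> simp
  · simp only [comulHom_V, Finset.sum_mul_sum, Algebra.TensorProduct.tmul_mul_tmul]
    rw [Finset.sum_comm]
    calc ∑ a, ∑ k, ∑ b, (V q θ i a * invV q θ b j) ⊗ₜ[ℂ] (V q θ a k * invV q θ k b)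
        = ∑ a, ∑ b, (V q θ i a * invV q θ b j) ⊗ₜ[ℂ] (if a = b then 1 else 0) := by
          refine Finset.sum_congr rfl fun a _ => ?_
          rw [Finset.sum_comm]
          refine Finset.sum_congr rfl fun b _ => ?_
          rw [← TensorProduct.tmul_sum, sum_V_mul_invV hq hθ]
      _ = (∑ a, V q θ i a * invV q θ a j) ⊗ₜ[ℂ] 1 := by
          simp [TensorProduct.tmul_ite, TensorProduct.sum_tmul]
      _ = _ := by
          rw [sum_V_mul_invV hq hθ]
          split_ifs <;> simp [Algebra.TensorProduct.one_def]

lemma counitHom_invV (hq : q ≠ 0) (hθ : IsParam θ) (i j : Fin n) :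
    counitHom q θ (invV q θ i j) = if i = j then 1 else 0 := by
  refine matrix_inverse_unique (t := fun i j => counitHom q θ (invV q θ i j))
    (v := fun i j => counitHom q θ (V q θ i j))
    (t' := fun i j => if i = j then 1 else 0) (fun i j => ?_) (fun i j => ?_) i j
  · simp only [← map_mul, ← map_sum, sum_invV_mul_V hq hθ]
    split_ifs <;> simp
  · simp

lemma comulHom_Det (hq : q ≠ 0) (hθ : IsParam θ) :
    comulHom hq hθ (Det q θ) = Det q θ ⊗ₜ Det q θ := by
  rw [Det, map_qDet]
  simp only [comulHom_V]
  exact qDet_tmul hq hθ isFRT_V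

lemma counitHom_Det : counitHom q θ (Det q θ) = 1 := by
  rw [Det, map_qDet]
  simp only [counitHom_V]
  exact qDet_one

/-- The star operation `S ∘ ω` makes `ℂ[U_{q,Θ}(n)]` a star ring. -/
abbrev CU.starRing (hq : q ≠ 0) (hθ : IsParam θ) (hω : IsTranspose q θ ω) :
    StarRing (CU n q θ) where
  star := starMap hq hθ ω
  star_involutive := starMap_starMap hq hθ hω
  star_mul a b := by simp [starMap]
  star_add a b := by simp [starMap]

lemma CU.starModule (hq : q ≠ 0) (hθ : IsParam θ) (hω : IsTranspose q θ ω) :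
    letI := CU.starRing hq hθ hω
    StarModule ℂ (CU n q θ) :=
  letI := CU.starRing hq hθ hω
  ⟨fun c a => by
    change antipodeMap hq hθ (ω (c • a)) = conj c • antipodeMap hq hθ (ω a)
    rw [hω.map_smul, map_smul]⟩

lemma CU.comulHom_star (hq : q ≠ 0) (hθ : IsParam θ) (hω : IsTranspose q θ ω) (a : CU n q θ) :
    letI := CU.starRing hq hθ hω
    haveI := CU.starModule hq hθ hω
    comulHom hq hθ (star a) = star (comulHom hq hθ a) := by
  let := CU.starRing hq hθ hω
  have := CU.starModule hq hθ hω
  have hstar : ∀ a, star a = antipodeMap hq hθ (ω a) := fun _ => rfl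
  change comulHom hq hθ (star a) = star (comulHom hq hθ a)
  induction a using CU.induction with
  | halg c =>
    rw [hstar, hω.map_algebraMap, antipodeMap_algebraMap, AlgHom.commutes, AlgHom.commutes,
      Algebra.algebraMap_eq_smul_one, Algebra.algebraMap_eq_smul_one, star_smul, star_one]
    rfl
  | hV i j =>
    rw [hstar, hω.map_V, antipodeMap_V, comulHom_invV, comulHom_V, star_sum]
    refine Finset.sum_congr rfl fun k _ => ?_
    rw [TensorProduct.star_tmul, hstar, hstar, hω.map_V, hω.map_V, antipodeMap_V, antipodeMap_V]
  | hD =>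
    rw [hstar, hω.map_Dinv, antipodeMap_Dinv, comulHom_Det, comulHom_Dinv,
      TensorProduct.star_tmul, hstar, hω.map_Dinv, antipodeMap_Dinv]
  | hmul a b ha hb => rw [star_mul, map_mul, map_mul, star_mul, ha, hb]
  | hadd a b ha hb => rw [star_add, map_add, map_add, star_add, ha, hb]

lemma CU.counitHom_starMap (hq : q ≠ 0) (hθ : IsParam θ) (hω : IsTranspose q θ ω) (a : CU n q θ) :
    counitHom q θ (starMap hq hθ ω a) = conj (counitHom q θ a) := by
  unfold starMap
  induction a using CU.induction with
  | halg c =>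
    rw [hω.map_algebraMap, antipodeMap_algebraMap, AlgHom.commutes, AlgHom.commutes]
    rfl
  | hV i j =>
    rw [hω.map_V, antipodeMap_V, counitHom_invV hq hθ, counitHom_V]
    by_cases h : i = j
    · simp [h]
    · simp [h, Ne.symm h]
  | hD => rw [hω.map_Dinv, antipodeMap_Dinv, counitHom_Det, counitHom_Dinv, map_one]
  | hmul a b ha hb =>
    rw [map_mul, antipodeMap_mul, map_mul, map_mul, map_mul, ha, hb, mul_comm]
  | hadd a b ha hb => rw [map_add, map_add, map_add, map_add, map_add, ha, hb]

/-- The Hopf `*`-algebra structure of `ℂ[U_{q,Θ}(n)]` with `* = S ∘ ω`. -/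
abbrev CU.hopfStarAlgebra (hq : q ≠ 0) (hθ : IsParam θ) (hω : IsTranspose q θ ω) :
    letI := CU.hopfAlgebra hq hθ
    HopfStarAlgebra (CU n q θ) :=
  letI := CU.hopfAlgebra hq hθ
  { toStarRing := CU.starRing hq hθ hω
    toStarModule := CU.starModule hq hθ hω
    comul_star := CU.comulHom_star hq hθ hω
    counit_star := CU.counitHom_starMap hq hθ hω }

end Square

end QuantumU

end

open QuantumU in
theorem mainTheorem3 (n : ℕ) (q : ℝ) (hq : q ≠ 0) (θ : Fin n → Fin n → ℂ) (hθ : IsParam θ) :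
    ∃ H : HopfAlgebra ℂ (CU n q θ),
      IsHopfStructure q θ H ∧
      (∀ H' : HopfAlgebra ℂ (CU n q θ), IsHopfStructure q θ H' → H' = H) ∧
      (∀ i k, H.antipode (V q θ i k) =
        (kappa θ i / kappa θ k * (-(q : ℂ)) ^ ((i : ℤ) - (k : ℤ))) •
          (Dinv q θ * M q θ k i)) ∧
      H.antipode (Dinv q θ) = Det q θ ∧
      (∀ i j, H.antipode (H.antipode (V q θ i j)) =
        ((q : ℂ) ^ (2 * ((i : ℤ) - (j : ℤ)))) • V q θ i j) ∧
      ∃ ω : CU n q θ →+* CU n q θ,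
        IsTranspose q θ ω ∧
        (∀ ω' : CU n q θ →+* CU n q θ, IsTranspose q θ ω' → ω' = ω) ∧
        ∃ T : HopfStarAlgebra (CU n q θ),
          (∀ a : CU n q θ, T.star a = H.antipode (ω a)) ∧
          ∀ a : CU n q θ, H.antipode (T.star (H.antipode (T.star a))) = a := by
  have hω := isTranspose_transposeMap (n := n) hq hθ
  refine ⟨CU.hopfAlgebra hq hθ, CU.isHopfStructure_hopfAlgebra hq hθ,
    fun H' h => h.unique (CU.isHopfStructure_hopfAlgebra hq hθ), antipodeMap_V hq hθ,
    antipodeMap_Dinv hq hθ, fun i j => ?_, transposeMap hq hθ, hω, fun ω' h => h.unique hω,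
    CU.hopfStarAlgebra hq hθ hω, fun _ => rfl, antipodeMap_starMap_antipodeMap_starMap hq hθ hω⟩
  exact (congrArg _ (antipodeMap_V hq hθ i j)).trans (antipodeMap_invV hq hθ i j)
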